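/- Let $n,p$ be natural numbers, let $\psi:\mathbb{R}^p\to\mathbb{R}$ be continuous with $\lim_{\|w\|\to\infty}\psi(w)=\infty$, and let $\mathcal{S}\subseteq\mathbb{R}^p$ be closed. For $X\in\mathbb{R}^{n\times p}$, $g\in\mathbb{R}^n$, $h\in\mathbb{R}^p$ and $\lambda\in[0,\infty)$ define, with $\|\cdot\|$ the Euclidean norm and $(x)_+=\max(x,0)$, $$\Phi_\lambda(X)=\min_{w\in\mathcal{S}}\ \lambda\|Xw\|+\psi(w),\qquad \phi_\lambda(g,h)=\min_{w\in\mathcal{S}}\ \lambda\,(\|w\|\|g\|-h^Tw)_++\psi(w),$$ and, for $\lambda=\infty$, $$\Phi_\infty(X)=\min_{w\in\mathcal{S},\ Xw=0}\psi(w),\qquad \phi_\infty(g,h)=\min_{w\in\mathcal{S},\ \|w\|\|g\|\le h^Tw}\psi(w),$$ where a minimum over the empty set is $+\infty$. Let $X\in\mathbb{R}^{n\times p}$ have independent standard normal entries, and let $g\in\mathbb{R}^n$, $h\in\mathbb{R}^p$ be such that their $n+p$ entries are independent standard normal. Then for every $\lambda\in[0,\infty)\cup\{\infty\}$: 1. For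 every $t\in\mathbb{R}$, $\ \mathbb{P}(\Phi_\lambda(X)<t)\le 2\,\mathbb{P}(\phi_\lambda(g,h)\le t)$. 2. If in addition $\mathcal{S}$ and $\psi$ are convex, then for every $t\in\mathbb{R}$, $\ \mathbb{P}(\Phi_\lambda(X)>t)\le 2\,\mathbb{P}(\phi_\lambda(g,h)\ge t)$, and consequently for all $\mu\in\mathbb{R}$ and $t>0$, $$\mathbb{P}(|\Phi_\lambda(X)-\mu|>t)\le 2\,\mathbb{P}(|\phi_\lambda(g,h)-\mu|\ge t).$$ -/

import Mathlib

open MeasureTheory ProbabilityTheory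
open scoped NNReal ENNReal

noncomputable section

/-- The family `ξ` consists of independent standard normal real random variables under `P`. -/
def IsStdGaussianFamily {Ω ι : Type*} [MeasurableSpace Ω] (P : Measure Ω) (ξ : ι → Ω → ℝ) : Prop :=
  (∀ i, HasLaw (ξ i) (gaussianReal 0 1) P) ∧ iIndepFun ξ P

/-- The optimal value of `min_{w ∈ K} f w`, as an extended real number; it is `⊤` when the problem
is infeasible (`K = ∅`). -/
def minValue {E : Type*} (K : Set E) (f : E → ℝ) : EReal :=
  ⨅ w ∈ K, (f w : EReal)

/-- An infeasible problem has value `+∞`. -/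
theorem minValue_empty {E : Type*} (f : E → ℝ) : minValue (∅ : Set E) f = ⊤ := by
  simp [minValue]

/-- For a continuous coercive objective and a nonempty closed feasible set the value is attained,
so that `minValue` is a minimum. -/
theorem exists_eq_minValue {p : ℕ} {K : Set (EuclideanSpace ℝ (Fin p))} (hK : IsClosed K)
    (hne : K.Nonempty) {f : EuclideanSpace ℝ (Fin p) → ℝ} (hf : Continuous f)
    (hlim : Filter.Tendsto f (Bornology.cobounded (EuclideanSpace ℝ (Fin p))) Filter.atTop) :
    ∃ w ∈ K, minValue K f = (f w : EReal) := by
  obtain ⟨w₀, hw₀⟩ := hne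
  rw [Metric.cobounded_eq_cocompact] at hlim
  obtain ⟨w, hw, hmin⟩ := hf.continuousOn.exists_isMinOn' hK hw₀
    ((hlim.eventually_ge_atTop (f w₀)).filter_mono inf_le_left)
  refine ⟨w, hw, le_antisymm (iInf₂_le w hw) (le_iInf₂ fun v hv => ?_)⟩
  exact_mod_cast hmin hv

/-- The primary problem. For finite `lam` it is `min_{w ∈ S} lam * ‖X w‖ + ψ w`; for `lam = ∞` it is
`min_{w ∈ S, X w = 0} ψ w`. -/
def primaryValue {n p : ℕ} (ψ : EuclideanSpace ℝ (Fin p) → ℝ) (S : Set (EuclideanSpace ℝ (Fin p)))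
    (lam : ℝ≥0∞) (X : Matrix (Fin n) (Fin p) ℝ) : EReal :=
  open scoped Classical in
  if lam = ∞ then minValue {w | w ∈ S ∧ X.toEuclideanLin w = 0} ψ
  else minValue S (fun w => lam.toReal * ‖X.toEuclideanLin w‖ + ψ w)

/-- The auxiliary problem. For finite `lam` it is
`min_{w ∈ S} lam * (‖w‖ * ‖g‖ - ⟪h, w⟫)₊ + ψ w`; for `lam = ∞` it is
`min_{w ∈ S, ‖w‖ * ‖g‖ ≤ ⟪h, w⟫} ψ w`. -/
def auxiliaryValue {n p : ℕ} (ψ : EuclideanSpace ℝ (Fin p) → ℝ)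
    (S : Set (EuclideanSpace ℝ (Fin p))) (lam : ℝ≥0∞)
    (g : EuclideanSpace ℝ (Fin n)) (h : EuclideanSpace ℝ (Fin p)) : EReal :=
  open scoped Classical in
  if lam = ∞ then minValue {w | w ∈ S ∧ ‖w‖ * ‖g‖ ≤ inner ℝ h w} ψ
  else minValue S (fun w => lam.toReal * max (‖w‖ * ‖g‖ - inner ℝ h w) 0 + ψ w)

end

/-!
The primary objective is a bilinear Gaussian maximum, `λ ‖X w‖ = max_{‖u‖ ≤ λ} uᵀ X w`, and the
auxiliary objective is the maximum over the same ball of the decoupled process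
`‖w‖ gᵀu - ‖u‖ hᵀw`. Adding an independent term `γ ‖u‖ ‖w‖` to `uᵀ X w` gives both processes the
same variances, and the covariances then differ by
`(‖u‖ ‖u'‖ - ⟪u, u'⟫) (‖w‖ ‖w'‖ - ⟪w, w'⟫)`, which is nonnegative and vanishes for `w = w'`. This is
the situation of Gordon's comparison inequality
(`measure_exists_forall_le_of_covariance`): the event that, for some `w`, the process stays below
its thresholds for all `u` is at most as likely for the bilinear process as for the decoupled one.
The term `γ ‖u‖ ‖w‖` is removed by restricting to `γ ≤ 0`, which costs the factor `2`
(`measure_bilinField_le_of_fintype`, `measure_bilinField_le`).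

Gordon's inequality for finite families is proved by interpolating along `sin θ • c + cos θ • d`
between the two coefficient families, taken on disjoint sets of independent normal variables.
Gaussian integration by parts turns the derivative of `𝔼 F` into a sum of covariance differences
times mixed second derivatives of `F` (`integral_linForms_le_integral_linForms`). The test function
`F` is a product over rows of `1 - ∏ sigmoid`, whose mixed derivatives across rows are nonnegative
and which converges to the indicator of the complementary event as the sigmoids steepen.

The lower tail follows with `w ∈ S` outside and `‖u‖ ≤ λ` inside. For the upper tail in the convex
case, only the compact convex set of `w ∈ S` with `ψ w ≤ t` matters, and Sion's minimax theorem
provides one `u` that certifies `λ ‖X w‖ + ψ w > t` for all of them; Gordon's inequality is then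
applied with the roles of `u` and `w` exchanged. Finally, by coercivity the values for `λ = ∞` are
the suprema of those for `λ = N ∈ ℕ` (`minValue_eq_iSup_penalized`), and the tail bounds pass to
the limit by continuity of measures along monotone sequences of events.
-/

/-! ### Gaussian integration by parts -/

lemma hasDerivAt_gaussianPDFReal (x : ℝ) :
    HasDerivAt (gaussianPDFReal 0 1) (-x * gaussianPDFReal 0 1 x) x := by
  have h : HasDerivAt (fun y : ℝ => -(y - 0) ^ 2 / (2 * ((1 : ℝ≥0) : ℝ))) (-x) x :=
    (((((hasDerivAt_id x).sub_const 0).pow 2).neg).div_const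
      (2 * ((1 : ℝ≥0) : ℝ))).congr_deriv (by simp; ring)
  exact ((h.exp).const_mul ((Real.sqrt (2 * Real.pi * ((1 : ℝ≥0) : ℝ)))⁻¹)).congr_deriv
    (by rw [gaussianPDFReal]; ring)

lemma integrable_mul_gaussianPDFReal : Integrable (fun x : ℝ => x * gaussianPDFReal 0 1 x) := by
  have h := (integrable_mul_exp_neg_mul_sq (b := 1 / 2) (by norm_num)).const_mul
    ((Real.sqrt (2 * Real.pi * ((1 : ℝ≥0) : ℝ)))⁻¹)
  refine h.congr (Filter.Eventually.of_forall fun x => ?_)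
  simp only [gaussianPDFReal]
  rw [show -(x - 0) ^ 2 / (2 * ((1 : ℝ≥0) : ℝ)) = -(1 / 2) * x ^ 2 by simp; ring]
  ring

/-- Stein's identity for one standard normal variable. -/
lemma integral_mul_gaussianReal {f f' : ℝ → ℝ} (hf : ∀ x, HasDerivAt f (f' x) x)
    (hf' : Continuous f') {C C' : ℝ} (hC : ∀ x, |f x| ≤ C) (hC' : ∀ x, |f' x| ≤ C') :
    ∫ x, x * f x ∂(gaussianReal 0 1) = ∫ x, f' x ∂(gaussianReal 0 1) := by
  have hcont : Continuous f := continuous_iff_continuousAt.2 fun x => (hf x).continuousAt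
  have i1 : Integrable (f * fun x => -x * gaussianPDFReal 0 1 x) := by
    refine (integrable_mul_gaussianPDFReal.neg.bdd_mul (c := C) hcont.aestronglyMeasurable
      (Filter.Eventually.of_forall hC)).congr (Filter.Eventually.of_forall fun x => ?_)
    simp
  have i2 : Integrable (f' * gaussianPDFReal 0 1) :=
    (integrable_gaussianPDFReal 0 1).bdd_mul (c := C') hf'.aestronglyMeasurable
      (Filter.Eventually.of_forall hC')
  have i3 : Integrable (f * gaussianPDFReal 0 1) :=
    (integrable_gaussianPDFReal 0 1).bdd_mul (c := C) hcont.aestronglyMeasurable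
      (Filter.Eventually.of_forall hC)
  have key := integral_mul_deriv_eq_deriv_mul_of_integrable (fun x _ => hf x)
    (fun x _ => hasDerivAt_gaussianPDFReal x) i1 i2 i3
  rw [integral_gaussianReal_eq_integral_smul one_ne_zero,
    integral_gaussianReal_eq_integral_smul one_ne_zero]
  calc ∫ x, gaussianPDFReal 0 1 x • (x * f x)
      = -∫ x, f x * (-x * gaussianPDFReal 0 1 x) := by
        rw [← integral_neg]; congr 1; ext x; simp; ring
    _ = ∫ x, f' x * gaussianPDFReal 0 1 x := by rw [key]; simp
    _ = _ := by congr 1; ext x; simp; ring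

/-- The law of a vector of independent standard normal variables indexed by `κ`. -/
noncomputable abbrev stdGaussianPi (κ : Type*) [Fintype κ] : Measure (κ → ℝ) :=
  Measure.pi fun _ => gaussianReal 0 1

section Pi

variable {κ : Type*} [Fintype κ]

/-- Resampling one coordinate preserves a product of probability measures. -/
lemma measurePreserving_update [DecidableEq κ] (k : κ) :
    MeasurePreserving (fun q : (κ → ℝ) × ℝ => Function.update q.1 k q.2)
      ((stdGaussianPi κ).prod (gaussianReal 0 1)) (stdGaussianPi κ) := by
  have hm : Measurable (fun q : (κ → ℝ) × ℝ => Function.update q.1 k q.2) := by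
    rw [measurable_pi_iff]
    intro i
    by_cases h : i = k
    · subst h; simpa using measurable_snd
    · simp only [Function.update_of_ne h]; fun_prop
  refine ⟨hm, (Measure.pi_eq fun s hs => ?_).symm⟩
  rw [Measure.map_apply hm (MeasurableSet.univ_pi hs)]
  have : (fun q : (κ → ℝ) × ℝ => Function.update q.1 k q.2) ⁻¹' Set.univ.pi s
      = (Set.univ.pi (Function.update s k Set.univ)) ×ˢ s k := by
    ext q
    simp only [Set.mem_preimage, Set.mem_pi, Set.mem_univ, true_implies, Set.mem_prod]
    constructor
    · intro h
      refine ⟨fun i => ?_, by simpa using h k⟩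
      by_cases hi : i = k
      · subst hi; simp
      · simpa [Function.update_of_ne hi] using h i
    · rintro ⟨h, h'⟩ i
      by_cases hi : i = k
      · subst hi; simpa using h'
      · simpa [Function.update_of_ne hi] using h i
  rw [this, Measure.prod_prod, Measure.pi_pi,
    ← Finset.prod_erase_mul Finset.univ _ (Finset.mem_univ k),
    ← Finset.prod_erase_mul Finset.univ (fun i => (gaussianReal 0 1) (s i)) (Finset.mem_univ k)]
  congr 1
  simp only [Function.update_self, measure_univ, mul_one]
  refine Finset.prod_congr rfl fun i hi => ?_
  rw [Function.update_of_ne (Finset.ne_of_mem_erase hi)]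

lemma integrable_eval_stdGaussianPi (k : κ) : Integrable (fun ξ : κ → ℝ => ξ k) (stdGaussianPi κ) :=
  (measurePreserving_eval (fun _ : κ => gaussianReal 0 1) k).integrable_comp_of_integrable
    ((memLp_id_gaussianReal (μ := 0) (v := 1) 1).integrable le_rfl)

/-- Stein's identity for a standard Gaussian vector. -/
lemma integral_eval_mul_stdGaussianPi [DecidableEq κ] (k : κ) {f f' : (κ → ℝ) → ℝ}
    (hf : ∀ ξ, HasDerivAt (fun s => f (Function.update ξ k s)) (f' ξ) (ξ k))
    (hfc : Continuous f) (hfc' : Continuous f')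
    {C C' : ℝ} (hC : ∀ x, |f x| ≤ C) (hC' : ∀ x, |f' x| ≤ C') :
    ∫ ξ, ξ k * f ξ ∂(stdGaussianPi κ) = ∫ ξ, f' ξ ∂(stdGaussianPi κ) := by
  have i1 : Integrable (fun ξ : κ → ℝ => ξ k * f ξ) (stdGaussianPi κ) :=
    (integrable_eval_stdGaussianPi k).mul_bdd (c := C) hfc.aestronglyMeasurable
      (Filter.Eventually.of_forall hC)
  have i2 : Integrable f' (stdGaussianPi κ) :=
    Integrable.of_bound hfc'.aestronglyMeasurable C' (Filter.Eventually.of_forall hC')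
  have hp := measurePreserving_update k
  have e1 := integral_map (μ := (stdGaussianPi κ).prod (gaussianReal 0 1))
    hp.measurable.aemeasurable (f := fun ξ : κ → ℝ => ξ k * f ξ)
    (by rw [hp.map_eq]; exact i1.aestronglyMeasurable)
  have e2 := integral_map (μ := (stdGaussianPi κ).prod (gaussianReal 0 1))
    hp.measurable.aemeasurable (f := f') (by rw [hp.map_eq]; exact i2.aestronglyMeasurable)
  rw [hp.map_eq] at e1 e2
  have j1 := integral_prod _ (hp.integrable_comp_of_integrable i1)
  have j2 := integral_prod _ (hp.integrable_comp_of_integrable i2)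
  simp only [Function.comp_def] at j1 j2
  rw [e1, e2, j1, j2]
  congr 1
  ext ξ
  simp only [Function.update_self]
  refine integral_mul_gaussianReal (C := C) (C' := C') (fun x => ?_) ?_ (fun x => hC _)
    (fun x => hC' _)
  · simpa using hf (Function.update ξ k x)
  · exact hfc'.comp (by fun_prop)

end Pi

/-! ### Interpolation between two Gaussian vectors -/

section Interpolation

variable {α κ : Type*} [Fintype α] [Fintype κ]

/-- The vector of linear forms with coefficient rows `m a`, evaluated at `ξ`. -/
def linForms (m : α → κ → ℝ) (ξ : κ → ℝ) (a : α) : ℝ := ∑ k, m a k * ξ k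

omit [Fintype α] in
lemma continuous_linForms (m : α → κ → ℝ) : Continuous (linForms m) := by
  unfold linForms; fun_prop

/-- Gaussian integration by parts for a function of linear forms. -/
lemma integral_eval_mul_linForms [DecidableEq κ] (m : α → κ → ℝ) (k : κ) {f : (α → ℝ) → ℝ}
    {f' : α → (α → ℝ) → ℝ} (hfc : Continuous f) (hfc' : ∀ a, Continuous (f' a)) {C : ℝ}
    (hC : ∀ x, |f x| ≤ C) (hC' : ∀ a x, |f' a x| ≤ C)
    (hf : ∀ x, HasFDerivAt f (∑ a, f' a x • ContinuousLinearMap.proj (R := ℝ) a) x) :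
    ∫ ξ, ξ k * f (linForms m ξ) ∂(stdGaussianPi κ)
      = ∫ ξ, ∑ a, f' a (linForms m ξ) * m a k ∂(stdGaussianPi κ) := by
  refine integral_eval_mul_stdGaussianPi k (C := C) (C' := ∑ a, C * |m a k|) (fun ξ => ?_)
    (hfc.comp (continuous_linForms m))
    (continuous_finsetSum _ fun a _ => ((hfc' a).comp (continuous_linForms m)).mul_const _)
    (fun _ => hC _) (fun ξ => ?_)
  · have hu : HasDerivAt (fun s => linForms m (Function.update ξ k s)) (fun a => m a k) (ξ k) := by
      rw [hasDerivAt_pi]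
      intro a
      have h := HasDerivAt.fun_sum (u := Finset.univ) (x := ξ k)
        (A := fun i s => m a i * Function.update ξ k s i)
        (A' := fun i => m a i * (Pi.single k (1 : ℝ) : κ → ℝ) i)
        fun i _ => ((hasDerivAt_pi.1 (hasDerivAt_update ξ k (ξ k))) i).const_mul (m a i)
      exact h.congr_deriv (by simp [Pi.single_apply])
    have h2 := HasFDerivAt.comp_hasDerivAt_of_eq (ξ k) (hf (linForms m ξ)) hu (by simp)
    exact h2.congr_deriv (by simp)
  · refine (Finset.abs_sum_le_sum_abs _ _).trans (Finset.sum_le_sum fun a _ => ?_)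
    rw [abs_mul]
    exact mul_le_mul_of_nonneg_right (hC' a _) (abs_nonneg _)

/-- A comparison principle for Gaussian vectors. If the two families of linear forms `c` and `d`
are uncorrelated with each other, then replacing `d` by `c` increases `𝔼 F` as soon as every
covariance increases where the mixed second derivative of `F` is positive, and decreases where it
is negative. -/
theorem integral_linForms_le_integral_linForms (c d : α → κ → ℝ)
    (horth : ∀ a b, ∑ k, c a k * d b k = 0)
    {F : (α → ℝ) → ℝ} {F₁ : α → (α → ℝ) → ℝ} {F₂ : α → α → (α → ℝ) → ℝ}
    (hFc : Continuous F) (hF₁c : ∀ a, Continuous (F₁ a)) (hF₂c : ∀ a b, Continuous (F₂ a b)) {C : ℝ}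
    (hFb : ∀ x, |F x| ≤ C) (hF₁b : ∀ a x, |F₁ a x| ≤ C) (hF₂b : ∀ a b x, |F₂ a b x| ≤ C)
    (hF : ∀ x, HasFDerivAt F (∑ a, F₁ a x • ContinuousLinearMap.proj (R := ℝ) a) x)
    (hF₁ : ∀ a x, HasFDerivAt (F₁ a) (∑ b, F₂ a b x • ContinuousLinearMap.proj (R := ℝ) b) x)
    (hpos : ∀ x a b, 0 ≤ F₂ a b x * (∑ k, c a k * c b k - ∑ k, d a k * d b k)) :
    ∫ ξ, F (linForms d ξ) ∂(stdGaussianPi κ) ≤ ∫ ξ, F (linForms c ξ) ∂(stdGaussianPi κ) := by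
  classical
  -- the rotation from `d` to `c`, and its derivative
  set m : ℝ → α → κ → ℝ := fun θ a k => Real.sin θ * c a k + Real.cos θ * d a k with hm
  set m' : ℝ → α → κ → ℝ := fun θ a k => Real.cos θ * c a k - Real.sin θ * d a k with hm'
  have hC0 : ∀ a : α, 0 ≤ C := fun a => (abs_nonneg _).trans (hFb 0)
  have hZ : ∀ ξ θ, HasDerivAt (fun t => linForms (m t) ξ) (linForms (m' θ) ξ) θ := by
    intro ξ θ
    rw [hasDerivAt_pi]
    intro a
    refine HasDerivAt.fun_sum fun k _ => ?_
    refine ((((Real.hasDerivAt_sin θ).mul_const _).add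
      ((Real.hasDerivAt_cos θ).mul_const _)).mul_const _).congr_deriv ?_
    simp only [hm']; ring
  have hint : ∀ θ a k, Integrable (fun ξ : κ → ℝ => ξ k * F₁ a (linForms (m θ) ξ))
      (stdGaussianPi κ) := fun θ a k =>
    (integrable_eval_stdGaussianPi k).mul_bdd (c := C)
      ((hF₁c a).comp (continuous_linForms _)).aestronglyMeasurable
      (Filter.Eventually.of_forall fun _ => hF₁b _ _)
  have hint2 : ∀ θ a b, Integrable (fun ξ : κ → ℝ => F₂ a b (linForms (m θ) ξ))
      (stdGaussianPi κ) := fun θ a b =>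
    Integrable.of_bound ((hF₂c a b).comp (continuous_linForms _)).aestronglyMeasurable C
      (Filter.Eventually.of_forall fun _ => hF₂b _ _ _)
  have hderiv : ∀ θ, HasDerivAt (fun t => ∫ ξ, F (linForms (m t) ξ) ∂(stdGaussianPi κ))
      (∫ ξ, ∑ a, F₁ a (linForms (m θ) ξ) * linForms (m' θ) ξ a ∂(stdGaussianPi κ)) θ := by
    intro θ
    refine (hasDerivAt_integral_of_dominated_loc_of_deriv_le (s := Set.univ)
      (F' := fun θ ξ => ∑ a, F₁ a (linForms (m θ) ξ) * linForms (m' θ) ξ a)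
      (bound := fun ξ => ∑ a, C * ∑ k, (|c a k| + |d a k|) * |ξ k|)
      Filter.univ_mem (Filter.Eventually.of_forall fun t =>
        (hFc.comp (continuous_linForms _)).aestronglyMeasurable)
      (Integrable.of_bound (hFc.comp (continuous_linForms _)).aestronglyMeasurable C
        (Filter.Eventually.of_forall fun _ => hFb _)) ?_ ?_ ?_ ?_).2
    · exact (continuous_finsetSum _ fun a _ => ((hF₁c a).comp (continuous_linForms _)).mul
        ((continuous_apply a).comp (continuous_linForms _))).aestronglyMeasurable
    · refine Filter.Eventually.of_forall fun ξ t _ => ?_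
      refine (Finset.abs_sum_le_sum_abs _ _).trans (Finset.sum_le_sum fun a _ => ?_)
      rw [abs_mul]
      refine mul_le_mul (hF₁b _ _) ?_ (abs_nonneg _) (hC0 a)
      refine (Finset.abs_sum_le_sum_abs _ _).trans (Finset.sum_le_sum fun k _ => ?_)
      rw [abs_mul]
      refine mul_le_mul_of_nonneg_right ((abs_sub _ _).trans (add_le_add ?_ ?_)) (abs_nonneg _)
      · rw [abs_mul]
        exact mul_le_of_le_one_left (abs_nonneg _) (Real.abs_cos_le_one _)
      · rw [abs_mul]
        exact mul_le_of_le_one_left (abs_nonneg _) (Real.abs_sin_le_one _)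
    · exact integrable_finsetSum _ fun a _ => (integrable_finsetSum _ fun k _ =>
        ((integrable_eval_stdGaussianPi k).abs.const_mul _)).const_mul _
    · refine Filter.Eventually.of_forall fun ξ t _ => ?_
      exact ((hF (linForms (m t) ξ)).comp_hasDerivAt t (hZ ξ t)).congr_deriv (by simp)
  have hval : ∀ θ, ∫ ξ, ∑ a, F₁ a (linForms (m θ) ξ) * linForms (m' θ) ξ a ∂(stdGaussianPi κ)
      = ∑ a, ∑ b, (Real.sin θ * Real.cos θ) *
        ((∑ k, c a k * c b k - ∑ k, d a k * d b k) *
          ∫ ξ, F₂ a b (linForms (m θ) ξ) ∂(stdGaussianPi κ)) := by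
    intro θ
    -- the terms in `cos²` and `sin²` are cross-covariances of `c` and `d`, hence vanish
    have hcov : ∀ a b, ∑ k, m' θ a k * m θ b k = (Real.sin θ * Real.cos θ) *
        (∑ k, c a k * c b k - ∑ k, d a k * d b k) := by
      intro a b
      have h1 := horth a b
      have h2 := horth b a
      calc ∑ k, m' θ a k * m θ b k
          = (Real.sin θ * Real.cos θ) * (∑ k, c a k * c b k - ∑ k, d a k * d b k)
            + Real.cos θ ^ 2 * ∑ k, c a k * d b k - Real.sin θ ^ 2 * ∑ k, c b k * d a k := by
            simp only [Finset.mul_sum, ← Finset.sum_sub_distrib, ← Finset.sum_add_distrib]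
            refine Finset.sum_congr rfl fun k _ => ?_
            simp only [hm, hm']; ring
        _ = _ := by rw [h1, h2]; ring
    have e1 : ∀ ξ : κ → ℝ, ∑ a, F₁ a (linForms (m θ) ξ) * linForms (m' θ) ξ a
        = ∑ a, ∑ k, m' θ a k * (ξ k * F₁ a (linForms (m θ) ξ)) := by
      intro ξ
      refine Finset.sum_congr rfl fun a _ => ?_
      conv_lhs => rw [linForms, Finset.mul_sum]
      exact Finset.sum_congr rfl fun k _ => by ring
    simp_rw [e1]
    rw [integral_finsetSum _ fun a _ => integrable_finsetSum _ fun k _ =>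
      (hint θ a k).const_mul _]
    refine Finset.sum_congr rfl fun a _ => ?_
    rw [integral_finsetSum _ fun k _ => (hint θ a k).const_mul _]
    calc ∑ k, ∫ ξ, m' θ a k * (ξ k * F₁ a (linForms (m θ) ξ)) ∂(stdGaussianPi κ)
        = ∑ k, ∑ b, m' θ a k * m θ b k *
            ∫ ξ, F₂ a b (linForms (m θ) ξ) ∂(stdGaussianPi κ) := by
          refine Finset.sum_congr rfl fun k _ => ?_
          rw [integral_const_mul, integral_eval_mul_linForms (m θ) k (hF₁c a) (hF₂c a) (hF₁b a)
            (hF₂b a) (hF₁ a), integral_finsetSum _ fun b _ => (hint2 θ a b).mul_const _,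
            Finset.mul_sum]
          refine Finset.sum_congr rfl fun b _ => ?_
          rw [integral_mul_const]; ring
      _ = _ := by
          rw [Finset.sum_comm]
          refine Finset.sum_congr rfl fun b _ => ?_
          rw [← Finset.sum_mul, hcov, mul_assoc]
  have hmono : MonotoneOn (fun t => ∫ ξ, F (linForms (m t) ξ) ∂(stdGaussianPi κ))
      (Set.Icc 0 (Real.pi / 2)) := by
    refine monotoneOn_of_deriv_nonneg (convex_Icc _ _)
      (fun θ _ => (hderiv θ).continuousAt.continuousWithinAt)
      (fun θ _ => (hderiv θ).differentiableAt.differentiableWithinAt) fun θ hθ => ?_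
    rw [interior_Icc] at hθ
    rw [(hderiv θ).deriv, hval]
    refine Finset.sum_nonneg fun a _ => Finset.sum_nonneg fun b _ => mul_nonneg (mul_nonneg
      (Real.sin_nonneg_of_nonneg_of_le_pi hθ.1.le (by linarith [hθ.2, Real.pi_pos]))
      (Real.cos_nonneg_of_mem_Icc ⟨by linarith [hθ.1, Real.pi_pos], hθ.2.le⟩)) ?_
    rw [← integral_const_mul]
    exact integral_nonneg fun ξ => by simpa [mul_comm] using hpos (linForms (m θ) ξ) a b
  have h := hmono (Set.left_mem_Icc.2 (by positivity)) (Set.right_mem_Icc.2 (by positivity))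
    (show (0 : ℝ) ≤ Real.pi / 2 by positivity)
  simpa [hm] using h

end Interpolation

/-! ### Smooth functions with bounded derivatives -/

section BddSmooth

variable {α : Type*} [Fintype α]

/-- `BddSmooth m f` says that `f` has `m` continuous derivatives, and that `f` and all its partial
derivatives up to order `m` are bounded. -/
def BddSmooth : ℕ → ((α → ℝ) → ℝ) → Prop
  | 0, f => Continuous f ∧ ∃ C, ∀ x, |f x| ≤ C
  | m + 1, f => (Continuous f ∧ ∃ C, ∀ x, |f x| ≤ C) ∧
      ∃ f' : α → (α → ℝ) → ℝ, (∀ a, BddSmooth m (f' a)) ∧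
        ∀ x, HasFDerivAt f (∑ a, f' a x • ContinuousLinearMap.proj (R := ℝ) a) x

lemma BddSmooth.continuous_bounded {m : ℕ} {f : (α → ℝ) → ℝ} (hf : BddSmooth m f) :
    Continuous f ∧ ∃ C, ∀ x, |f x| ≤ C := by
  cases m with
  | zero => exact hf
  | succ m => exact hf.1

lemma BddSmooth.of_succ {m : ℕ} : ∀ {f : (α → ℝ) → ℝ}, BddSmooth (m + 1) f → BddSmooth m f := by
  induction m with
  | zero => intro f hf; exact hf.1
  | succ m ih =>
    rintro f ⟨h, f', hf', hd⟩
    exact ⟨h, f', fun a => ih (hf' a), hd⟩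

lemma bddSmooth_const (m : ℕ) (c : ℝ) : BddSmooth m (fun _ : α → ℝ => c) := by
  have h0 : ∀ c : ℝ, Continuous (fun _ : α → ℝ => c) ∧ ∃ C, ∀ _ : α → ℝ, |c| ≤ C :=
    fun c => ⟨continuous_const, |c|, fun _ => le_rfl⟩
  induction m generalizing c with
  | zero => exact h0 c
  | succ m ih =>
    exact ⟨h0 c, fun _ _ => 0, fun _ => ih 0, fun x => by simpa using hasFDerivAt_const c x⟩

lemma BddSmooth.add {m : ℕ} : ∀ {f g : (α → ℝ) → ℝ}, BddSmooth m f → BddSmooth m g →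
    BddSmooth m (fun x => f x + g x) := by
  have h0 : ∀ {f g : (α → ℝ) → ℝ}, (Continuous f ∧ ∃ C, ∀ x, |f x| ≤ C) →
      (Continuous g ∧ ∃ C, ∀ x, |g x| ≤ C) →
      (Continuous (fun x => f x + g x) ∧ ∃ C, ∀ x, |f x + g x| ≤ C) := by
    rintro f g ⟨hf, C, hC⟩ ⟨hg, D, hD⟩
    exact ⟨hf.add hg, C + D, fun x => (abs_add_le _ _).trans (add_le_add (hC x) (hD x))⟩
  induction m with
  | zero => intro f g hf hg; exact h0 hf hg
  | succ m ih =>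
    rintro f g ⟨hf, f', hf', hfd⟩ ⟨hg, g', hg', hgd⟩
    refine ⟨h0 hf hg, fun a x => f' a x + g' a x, fun a => ih (hf' a) (hg' a), fun x => ?_⟩
    refine ((hfd x).add (hgd x)).congr_fderiv ?_
    simp [add_smul, Finset.sum_add_distrib]

lemma BddSmooth.mul {m : ℕ} : ∀ {f g : (α → ℝ) → ℝ}, BddSmooth m f → BddSmooth m g →
    BddSmooth m (fun x => f x * g x) := by
  have h0 : ∀ {f g : (α → ℝ) → ℝ}, (Continuous f ∧ ∃ C, ∀ x, |f x| ≤ C) →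
      (Continuous g ∧ ∃ C, ∀ x, |g x| ≤ C) →
      (Continuous (fun x => f x * g x) ∧ ∃ C, ∀ x, |f x * g x| ≤ C) := by
    rintro f g ⟨hf, C, hC⟩ ⟨hg, D, hD⟩
    refine ⟨hf.mul hg, C * D, fun x => ?_⟩
    rw [abs_mul]
    exact mul_le_mul (hC x) (hD x) (abs_nonneg _) ((abs_nonneg _).trans (hC x))
  induction m with
  | zero => intro f g hf hg; exact h0 hf hg
  | succ m ih =>
    rintro f g hf hg
    have hf0 := hf.of_succ
    have hg0 := hg.of_succ
    obtain ⟨hf, f', hf', hfd⟩ := hf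
    obtain ⟨hg, g', hg', hgd⟩ := hg
    refine ⟨h0 hf hg, fun a x => f x * g' a x + f' a x * g x,
      fun a => (ih hf0 (hg' a)).add (ih (hf' a) hg0), fun x => ?_⟩
    refine ((hfd x).mul (hgd x)).congr_fderiv ?_
    simp only [add_smul, Finset.sum_add_distrib, Finset.smul_sum, smul_smul]
    simp [mul_comm]

lemma BddSmooth.prod {m : ℕ} {ι : Type*} (s : Finset ι) {f : ι → (α → ℝ) → ℝ}
    (hf : ∀ i ∈ s, BddSmooth m (f i)) : BddSmooth m (fun x => ∏ i ∈ s, f i x) := by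
  classical
  induction s using Finset.induction_on with
  | empty => simpa using bddSmooth_const m 1
  | insert i s hi ih =>
    simp only [Finset.prod_insert hi]
    exact (hf i (by simp)).mul (ih fun j hj => hf j (by simp [hj]))

lemma BddSmooth.one_sub {m : ℕ} {f : (α → ℝ) → ℝ} (hf : BddSmooth m f) :
    BddSmooth m (fun x => 1 - f x) := by
  have := (bddSmooth_const m 1).add ((bddSmooth_const m (-1)).mul hf)
  simpa [sub_eq_add_neg] using this

lemma hasFDerivAt_sigmoid_eval (K L t : ℝ) (a : α) (x : α → ℝ) :
    HasFDerivAt (fun x : α → ℝ => Real.sigmoid (K * (t - x a) + L))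
      ((-K * (Real.sigmoid (K * (t - x a) + L) * (1 - Real.sigmoid (K * (t - x a) + L)))) •
        ContinuousLinearMap.proj (R := ℝ) a) x := by
  have h1 : HasFDerivAt (fun x : α → ℝ => K * (t - x a) + L)
      (-K • ContinuousLinearMap.proj (R := ℝ) (φ := fun _ : α => ℝ) a) x := by
    have := ((((ContinuousLinearMap.proj (R := ℝ) (φ := fun _ : α => ℝ) a).hasFDerivAt
      (x := x)).const_sub t).const_mul K).add_const L
    exact this.congr_fderiv (by ext; simp)
  exact ((Real.hasDerivAt_sigmoid _).comp_hasFDerivAt x h1).congr_fderiv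
    (by rw [smul_smul]; congr 1; ring)

lemma bddSmooth_sigmoid_eval (m : ℕ) (K L t : ℝ) (a : α) :
    BddSmooth m (fun x : α → ℝ => Real.sigmoid (K * (t - x a) + L)) := by
  classical
  have h0 : Continuous (fun x : α → ℝ => Real.sigmoid (K * (t - x a) + L)) ∧
      ∃ C, ∀ x : α → ℝ, |Real.sigmoid (K * (t - x a) + L)| ≤ C :=
    ⟨continuous_sigmoid.comp (by fun_prop), 1, fun x => by
      rw [abs_of_nonneg (Real.sigmoid_nonneg _)]; exact Real.sigmoid_le_one _⟩
  induction m with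
  | zero => exact h0
  | succ m ih =>
    refine ⟨h0, fun b x => (if b = a then -K else 0) *
      (Real.sigmoid (K * (t - x a) + L) * (1 - Real.sigmoid (K * (t - x a) + L))),
      fun b => (bddSmooth_const m _).mul (ih.mul ih.one_sub), fun x => ?_⟩
    refine (hasFDerivAt_sigmoid_eval K L t a x).congr_fderiv ?_
    simp [ite_smul]

end BddSmooth

/-! ### Gordon's comparison inequality for finite families -/

section FiniteGordon

variable {I J : Type*} [Fintype I] [Fintype J]

/-- A smooth version of the indicator of `{x | ∀ i, ∃ j, t (i, j) < x (i, j)}`: each indicator of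
`{x (i, j) ≤ t (i, j)}` is replaced by a sigmoid of slope `K`, shifted by `L`. -/
noncomputable def smoothIndicator (t : I × J → ℝ) (K L : ℝ) (x : I × J → ℝ) : ℝ :=
  ∏ i, (1 - ∏ j, Real.sigmoid (K * (t (i, j) - x (i, j)) + L))

/-- The partial derivatives of `smoothIndicator`. -/
noncomputable def smoothIndicatorDeriv [DecidableEq I] [DecidableEq J] (t : I × J → ℝ) (K L : ℝ)
    (a : I × J) (x : I × J → ℝ) : ℝ :=
  (∏ i ∈ Finset.univ.erase a.1, (1 - ∏ j, Real.sigmoid (K * (t (i, j) - x (i, j)) + L))) *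
    ((∏ j ∈ Finset.univ.erase a.2, Real.sigmoid (K * (t (a.1, j) - x (a.1, j)) + L)) *
      (K * (Real.sigmoid (K * (t a - x a) + L) * (1 - Real.sigmoid (K * (t a - x a) + L)))))

variable (t : I × J → ℝ) (K L : ℝ)

lemma bddSmooth_one_sub_prod (m : ℕ) (i : I) : BddSmooth m
    (fun x : I × J → ℝ => 1 - ∏ j, Real.sigmoid (K * (t (i, j) - x (i, j)) + L)) :=
  (BddSmooth.prod _ fun j _ => bddSmooth_sigmoid_eval m K L (t (i, j)) (i, j)).one_sub

lemma bddSmooth_smoothIndicatorDeriv [DecidableEq I] [DecidableEq J] (m : ℕ) (a : I × J) :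
    BddSmooth m (smoothIndicatorDeriv t K L a) := by
  refine BddSmooth.mul (BddSmooth.prod _ fun i _ => bddSmooth_one_sub_prod t K L m i)
    (BddSmooth.mul (BddSmooth.prod _ fun j _ => bddSmooth_sigmoid_eval m K L _ (a.1, j))
      ((bddSmooth_const m K).mul ?_))
  exact (bddSmooth_sigmoid_eval m K L _ a).mul (bddSmooth_sigmoid_eval m K L _ a).one_sub

lemma hasFDerivAt_smoothIndicator [DecidableEq I] [DecidableEq J] (x : I × J → ℝ) :
    HasFDerivAt (smoothIndicator t K L)
      (∑ a, smoothIndicatorDeriv t K L a x •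
        ContinuousLinearMap.proj (R := ℝ) (φ := fun _ : I × J => ℝ) a) x := by
  have h1 : ∀ i, HasFDerivAt
      (fun x : I × J → ℝ => 1 - ∏ j, Real.sigmoid (K * (t (i, j) - x (i, j)) + L)) _ x :=
    fun i => (HasFDerivAt.finsetProd (u := Finset.univ) fun j _ =>
      hasFDerivAt_sigmoid_eval K L (t (i, j)) (i, j) x).const_sub 1
  refine (HasFDerivAt.finsetProd (u := Finset.univ) fun i _ => h1 i).congr_fderiv ?_
  rw [Fintype.sum_prod_type]
  refine Finset.sum_congr rfl fun i _ => ?_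
  rw [← Finset.sum_neg_distrib, Finset.smul_sum]
  refine Finset.sum_congr rfl fun j _ => ?_
  rw [smul_smul, ← neg_smul, smul_smul]
  simp only [smoothIndicatorDeriv]
  congr 1
  ring

omit [Fintype J] in
lemma sigmoid_prod_mem (s : Finset J) (f : J → ℝ) :
    0 ≤ ∏ j ∈ s, Real.sigmoid (f j) ∧ ∏ j ∈ s, Real.sigmoid (f j) ≤ 1 :=
  ⟨Finset.prod_nonneg fun _ _ => Real.sigmoid_nonneg _,
    Finset.prod_le_one (fun _ _ => Real.sigmoid_nonneg _) fun _ _ => Real.sigmoid_le_one _⟩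

/-- The partial derivative at an entry of one row increases with the entries of the other rows, so
the mixed second derivatives across rows are nonnegative. -/
lemma monotone_smoothIndicatorDeriv [DecidableEq I] [DecidableEq J] (hK : 0 ≤ K) {a b : I × J}
    (hab : a.1 ≠ b.1) (x : I × J → ℝ) :
    Monotone fun s => smoothIndicatorDeriv t K L a (Function.update x b s) := by
  intro s s' hs
  have hrow : ∀ j, Function.update x b s (a.1, j) = x (a.1, j) ∧
      Function.update x b s' (a.1, j) = x (a.1, j) := fun j => by
    have : (a.1, j) ≠ b := fun h => hab (by rw [← h])
    simp [Function.update_of_ne this]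
  simp only [smoothIndicatorDeriv, (hrow _).1, (hrow _).2]
  refine mul_le_mul_of_nonneg_right ?_ (mul_nonneg (sigmoid_prod_mem _ _).1 (mul_nonneg hK
    (mul_nonneg (Real.sigmoid_nonneg _) (sub_nonneg.2 (Real.sigmoid_le_one _)))))
  refine Finset.prod_le_prod (fun i _ => sub_nonneg.2 (sigmoid_prod_mem _ _).2) fun i _ => ?_
  refine sub_le_sub_left (Finset.prod_le_prod (fun _ _ => Real.sigmoid_nonneg _) fun j _ => ?_) 1
  refine Real.sigmoid_monotone (add_le_add_left (mul_le_mul_of_nonneg_left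
    (sub_le_sub_left ?_ _) hK) _)
  by_cases h : (i, j) = b
  · simpa [h] using hs
  · simp [Function.update_of_ne h]

lemma smoothIndicator_mem (x : I × J → ℝ) :
    0 ≤ smoothIndicator t K L x ∧ smoothIndicator t K L x ≤ 1 :=
  ⟨Finset.prod_nonneg fun _ _ => sub_nonneg.2 (sigmoid_prod_mem _ _).2,
    Finset.prod_le_one (fun _ _ => sub_nonneg.2 (sigmoid_prod_mem _ _).2)
      fun _ _ => sub_le_self _ (sigmoid_prod_mem _ _).1⟩

lemma continuous_smoothIndicator : Continuous (smoothIndicator t K L) :=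
  (BddSmooth.prod (m := 0) _ fun i _ => bddSmooth_one_sub_prod t K L 0 i).1

variable {κ : Type*} [Fintype κ]

lemma integral_smoothIndicator_le (hK : 0 ≤ K) (c d : I × J → κ → ℝ)
    (horth : ∀ a b, ∑ k, c a k * d b k = 0)
    (heq : ∀ a b : I × J, a.1 = b.1 → ∑ k, c a k * c b k = ∑ k, d a k * d b k)
    (hle : ∀ a b : I × J, ∑ k, d a k * d b k ≤ ∑ k, c a k * c b k) :
    ∫ ξ, smoothIndicator t K L (linForms d ξ) ∂(stdGaussianPi κ)
      ≤ ∫ ξ, smoothIndicator t K L (linForms c ξ) ∂(stdGaussianPi κ) := by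
  classical
  have h1 := fun a => bddSmooth_smoothIndicatorDeriv t K L 1 a
  choose hb₁ F₂ hF₂ hF₁d using h1
  choose hc₁ C₁ hC₁ using hb₁
  have hF₂' := fun a b => (hF₂ a b).continuous_bounded
  choose hc₂ C₂ hC₂ using hF₂'
  set C : ℝ := 1 + ∑ a, |C₁ a| + ∑ a, ∑ b, |C₂ a b| with hC
  have hs1 : ∀ a, |C₁ a| ≤ ∑ a, |C₁ a| := fun a =>
    Finset.single_le_sum (f := fun a => |C₁ a|) (fun _ _ => abs_nonneg _) (Finset.mem_univ a)
  have hs2 : ∀ a b, |C₂ a b| ≤ ∑ a, ∑ b, |C₂ a b| := fun a b =>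
    (Finset.single_le_sum (f := fun b => |C₂ a b|) (fun _ _ => abs_nonneg _)
      (Finset.mem_univ b)).trans (Finset.single_le_sum (f := fun a => ∑ b, |C₂ a b|)
        (fun _ _ => Finset.sum_nonneg fun _ _ => abs_nonneg _) (Finset.mem_univ a))
  have hn1 : 0 ≤ ∑ a, |C₁ a| := Finset.sum_nonneg fun _ _ => abs_nonneg _
  have hn2 : 0 ≤ ∑ a, ∑ b, |C₂ a b| :=
    Finset.sum_nonneg fun _ _ => Finset.sum_nonneg fun _ _ => abs_nonneg _
  refine integral_linForms_le_integral_linForms c d horth (C := C)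
    (continuous_smoothIndicator t K L) hc₁ hc₂ (fun x => ?_)
    (fun a x => ?_) (fun a b x => ?_) (hasFDerivAt_smoothIndicator t K L) hF₁d
    (fun x a b => ?_)
  · rw [abs_of_nonneg (smoothIndicator_mem t K L x).1]
    linarith [(smoothIndicator_mem t K L x).2]
  · linarith [hC₁ a x, le_abs_self (C₁ a), hs1 a]
  · linarith [hC₂ a b x, le_abs_self (C₂ a b), hs2 a b]
  · by_cases hab : a.1 = b.1
    · rw [heq a b hab]; simp
    · refine mul_nonneg ?_ (sub_nonneg.2 (hle a b))
      have hd : HasDerivAt (fun s => smoothIndicatorDeriv t K L a (Function.update x b s))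
          (F₂ a b x) (x b) := by
        have := HasFDerivAt.comp_hasDerivAt_of_eq (x b) (hF₁d a x) (hasDerivAt_update x b (x b))
          (by simp)
        exact this.congr_deriv (by simp [Pi.single_apply])
      rw [← hd.deriv]
      exact (monotone_smoothIndicatorDeriv t K L hK hab x).deriv_nonneg

/-- The shift `N`, of lower order than the slope `N ^ 2`, makes the limit equal to `1` at the
threshold `x = t` itself, so that degenerate Gaussian variables need no separate treatment. -/
lemma tendsto_sigmoid_step (t x : ℝ) :
    Filter.Tendsto (fun N : ℕ => Real.sigmoid ((N : ℝ) ^ 2 * (t - x) + N)) Filter.atTop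
      (nhds (if x ≤ t then 1 else 0)) := by
  have hN : Filter.Tendsto (fun N : ℕ => (N : ℝ)) Filter.atTop Filter.atTop :=
    tendsto_natCast_atTop_atTop
  split_ifs with h
  · refine Real.tendsto_sigmoid_atTop.comp (Filter.tendsto_atTop_mono (fun N => ?_) hN)
    nlinarith [sq_nonneg (N : ℝ), mul_nonneg (sq_nonneg (N : ℝ)) (sub_nonneg.2 h)]
  · push Not at h
    refine Real.tendsto_sigmoid_atBot.comp ?_
    have h2 : Filter.Tendsto (fun N : ℕ => (N : ℝ) * (1 - N * (x - t))) Filter.atTop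
        Filter.atBot := by
      refine hN.atTop_mul_atBot₀ ?_
      have := Filter.tendsto_neg_atTop_atBot.comp (hN.atTop_mul_const (sub_pos.2 h))
      exact Filter.tendsto_atBot_add_const_left _ 1 this
    exact h2.congr fun N => by ring

/-- Gordon's inequality for finite families of Gaussian variables, with events given by thresholds:
if the covariances within the rows agree, and the covariances across rows are larger for `c` than
for `d`, then the event that some row stays below all its thresholds is at most as likely for `c` as
for `d`. -/
theorem measure_exists_forall_le_of_covariance (c d : I × J → κ → ℝ)
    (horth : ∀ a b, ∑ k, c a k * d b k = 0)
    (heq : ∀ a b : I × J, a.1 = b.1 → ∑ k, c a k * c b k = ∑ k, d a k * d b k)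
    (hle : ∀ a b : I × J, ∑ k, d a k * d b k ≤ ∑ k, c a k * c b k) :
    stdGaussianPi κ {ξ | ∃ i, ∀ j, linForms c ξ (i, j) ≤ t (i, j)}
      ≤ stdGaussianPi κ {ξ | ∃ i, ∀ j, linForms d ξ (i, j) ≤ t (i, j)} := by
  classical
  have hmeas : ∀ m : I × J → κ → ℝ,
      MeasurableSet {ξ : κ → ℝ | ∃ i, ∀ j, linForms m ξ (i, j) ≤ t (i, j)} := by
    intro m
    have : {ξ : κ → ℝ | ∃ i, ∀ j, linForms m ξ (i, j) ≤ t (i, j)}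
        = ⋃ i, ⋂ j, {ξ | linForms m ξ (i, j) ≤ t (i, j)} := by ext; simp
    rw [this]
    exact MeasurableSet.iUnion fun i => MeasurableSet.iInter fun j =>
      measurableSet_le ((continuous_apply _).comp (continuous_linForms m)).measurable
        measurable_const
  have hlim : ∀ m : I × J → κ → ℝ, Filter.Tendsto
      (fun N : ℕ => ∫ ξ, smoothIndicator t ((N : ℝ) ^ 2) N (linForms m ξ) ∂(stdGaussianPi κ))
      Filter.atTop (nhds ((stdGaussianPi κ).real
        {ξ | ∃ i, ∀ j, linForms m ξ (i, j) ≤ t (i, j)}ᶜ)) := by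
    intro m
    rw [← integral_indicator_one (hmeas m).compl]
    refine tendsto_integral_of_dominated_convergence (fun _ => 1)
      (fun N => ((continuous_smoothIndicator t _ _).comp
        (continuous_linForms m)).aestronglyMeasurable) (integrable_const _)
      (fun N => Filter.Eventually.of_forall fun ξ => ?_) (Filter.Eventually.of_forall fun ξ => ?_)
    · rw [Real.norm_of_nonneg (smoothIndicator_mem _ _ _ _).1]
      exact (smoothIndicator_mem _ _ _ _).2
    · have h1 : Filter.Tendsto (fun N : ℕ => smoothIndicator t ((N : ℝ) ^ 2) N (linForms m ξ))
          Filter.atTop (nhds (∏ i, (1 - ∏ j, if linForms m ξ (i, j) ≤ t (i, j) then 1 else 0))) :=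
        tendsto_finsetProd _ fun i _ => tendsto_const_nhds.sub
          (tendsto_finsetProd _ fun j _ => tendsto_sigmoid_step _ _)
      convert h1 using 2
      by_cases h : ∃ i, ∀ j, linForms m ξ (i, j) ≤ t (i, j)
      · rw [Set.indicator_of_notMem (by simpa using h)]
        obtain ⟨i, hi⟩ := h
        refine (Finset.prod_eq_zero (Finset.mem_univ i) ?_).symm
        simp [hi]
      · rw [Set.indicator_of_mem (by simpa using h)]
        refine (Finset.prod_eq_one fun i _ => ?_).symm
        push Not at h
        obtain ⟨j, hj⟩ := h i
        rw [Finset.prod_eq_zero (Finset.mem_univ j) (if_neg (not_le.2 hj)), sub_zero]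
  have hfin := le_of_tendsto_of_tendsto' (hlim d) (hlim c) fun N =>
    integral_smoothIndicator_le t _ _ (sq_nonneg _) c d horth heq hle
  rw [probReal_compl_eq_one_sub (hmeas d), probReal_compl_eq_one_sub (hmeas c)] at hfin
  have h2 : (stdGaussianPi κ).real {ξ | ∃ i, ∀ j, linForms c ξ (i, j) ≤ t (i, j)} ≤
      (stdGaussianPi κ).real {ξ | ∃ i, ∀ j, linForms d ξ (i, j) ≤ t (i, j)} := by linarith
  exact (ENNReal.toReal_le_toReal (measure_ne_top _ _) (measure_ne_top _ _)).1 h2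

end FiniteGordon

/-! ### Symmetries and marginals of the standard Gaussian measure -/

section Marginals

variable {κ κ' : Type*} [Fintype κ] [Fintype κ']

/-- The joint law of a standard Gaussian family. -/
lemma IsStdGaussianFamily.aemeasurable_and_map_eq {Ω : Type*} [MeasurableSpace Ω] {P : Measure Ω}
    [IsProbabilityMeasure P] {ξ : κ → Ω → ℝ} (h : IsStdGaussianFamily P ξ) :
    AEMeasurable (fun ω k => ξ k ω) P ∧ P.map (fun ω k => ξ k ω) = stdGaussianPi κ := by
  have hm : ∀ k, AEMeasurable (ξ k) P := fun k => (h.1 k).aemeasurable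
  refine ⟨aemeasurable_pi_lambda _ hm, ?_⟩
  rw [h.2.map_fun_eq_pi_map hm]
  congr 1
  ext k : 1
  exact (h.1 k).map_eq

lemma IsStdGaussianFamily.measure_setOf {Ω : Type*} [MeasurableSpace Ω] {P : Measure Ω}
    [IsProbabilityMeasure P] {ξ : κ → Ω → ℝ} (h : IsStdGaussianFamily P ξ) {E : Set (κ → ℝ)}
    (hE : MeasurableSet E) : P {ω | (fun k => ξ k ω) ∈ E} = stdGaussianPi κ E := by
  rw [← h.aemeasurable_and_map_eq.2,
    Measure.map_apply_of_aemeasurable h.aemeasurable_and_map_eq.1 hE]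
  rfl

lemma isStdGaussianFamily_eval : IsStdGaussianFamily (stdGaussianPi κ) (fun k ξ => ξ k) := by
  refine ⟨fun k => ⟨(measurable_pi_apply k).aemeasurable, ?_⟩, ?_⟩
  · exact (measurePreserving_eval (fun _ : κ => gaussianReal 0 1) k).map_eq
  · exact iIndepFun_pi (μ := fun _ : κ => gaussianReal 0 1) (X := fun _ => id)
      fun _ => aemeasurable_id

/-- Distinct coordinates of a standard Gaussian vector form a standard Gaussian vector. -/
lemma stdGaussianPi_preimage_precomp {e : κ' → κ} (he : e.Injective) {E : Set (κ' → ℝ)}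
    (hE : MeasurableSet E) :
    stdGaussianPi κ {ξ | (fun k => ξ (e k)) ∈ E} = stdGaussianPi κ' E := by
  have h : IsStdGaussianFamily (stdGaussianPi κ) (fun k (ξ : κ → ℝ) => ξ (e k)) :=
    ⟨fun k => isStdGaussianFamily_eval.1 (e k), isStdGaussianFamily_eval.2.precomp he⟩
  exact h.measure_setOf hE

/-- Changing the signs of some coordinates preserves the standard Gaussian measure. -/
lemma measurePreserving_sign (s : κ → Prop) [DecidablePred s] :
    MeasurePreserving (fun (ξ : κ → ℝ) k => if s k then -ξ k else ξ k)
      (stdGaussianPi κ) (stdGaussianPi κ) := by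
  refine measurePreserving_pi (fun _ : κ => gaussianReal 0 1) (fun _ : κ => gaussianReal 0 1)
    (f := fun k x => if s k then -x else x) fun k => ?_
  by_cases h : s k
  · simp only [h, if_true]
    exact ⟨measurable_neg, by simpa using gaussianReal_map_neg (μ := 0) (v := 1)⟩
  · simp only [h, if_false]
    exact MeasurePreserving.id _

/-- If a measure-preserving map `T` fixes the event `E`, and each point of `E` or its image lies
in `H`, then `H` captures at least half of `E`. -/
lemma measure_le_two_mul_inter {Ω : Type*} [MeasurableSpace Ω] {μ : Measure Ω} {T : Ω → Ω}
    (hT : MeasurePreserving T μ μ) {E H : Set Ω} (hE : MeasurableSet E) (hH : MeasurableSet H)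
    (hTE : T ⁻¹' E = E) (hTH : ∀ ω, ω ∈ H ∨ T ω ∈ H) : μ E ≤ 2 * μ (E ∩ H) := by
  calc μ E ≤ μ ((E ∩ H) ∪ T ⁻¹' (E ∩ H)) := by
        refine measure_mono fun ω hω => ?_
        rcases hTH ω with h | h
        · exact Or.inl ⟨hω, h⟩
        · exact Or.inr ⟨by rw [← hTE] at hω; exact hω, h⟩
    _ ≤ μ (E ∩ H) + μ (T ⁻¹' (E ∩ H)) := measure_union_le _ _
    _ = 2 * μ (E ∩ H) := by
        rw [hT.measure_preimage (hE.inter hH).nullMeasurableSet, two_mul]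

end Marginals

/-! ### Gordon's inequality for bilinear Gaussian processes -/

section Bilinear

variable {ι τ : Type*} [Fintype ι] [Fintype τ]

/-- The bilinear form `uᵀ X w`. -/
def bilinField (x : ι × τ → ℝ) (u : EuclideanSpace ℝ ι) (w : EuclideanSpace ℝ τ) : ℝ :=
  ∑ q, u q.1 * w q.2 * x q

/-- The decoupled process `‖w‖ gᵀu - ‖u‖ hᵀw`, where `y` lists the entries of `g` and of `h`. -/
noncomputable def splitField (y : ι ⊕ τ → ℝ) (u : EuclideanSpace ℝ ι)
    (w : EuclideanSpace ℝ τ) : ℝ :=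
  ‖w‖ * ∑ i, u i * y (Sum.inl i) - ‖u‖ * ∑ j, w j * y (Sum.inr j)

lemma continuous_bilinField : Continuous
    fun q : (ι × τ → ℝ) × EuclideanSpace ℝ ι × EuclideanSpace ℝ τ =>
      bilinField q.1 q.2.1 q.2.2 := by
  unfold bilinField; fun_prop

lemma continuous_splitField : Continuous
    fun q : (ι ⊕ τ → ℝ) × EuclideanSpace ℝ ι × EuclideanSpace ℝ τ =>
      splitField q.1 q.2.1 q.2.2 := by
  unfold splitField; fun_prop

/-- Coefficients of `uᵀ X w + γ ‖u‖ ‖w‖` as a linear form in the entries of `X`, an extra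
variable `γ`, and two further vectors on which it does not depend. -/
noncomputable def bilinCoeff (u : EuclideanSpace ℝ ι) (w : EuclideanSpace ℝ τ) :
    (ι × τ) ⊕ (Unit ⊕ (ι ⊕ τ)) → ℝ :=
  Sum.elim (fun q => u q.1 * w q.2) (Sum.elim (fun _ => ‖u‖ * ‖w‖) fun _ => 0)

/-- Coefficients of the decoupled process in the same variables. -/
noncomputable def splitCoeff (u : EuclideanSpace ℝ ι) (w : EuclideanSpace ℝ τ) :
    (ι × τ) ⊕ (Unit ⊕ (ι ⊕ τ)) → ℝ :=
  Sum.elim (fun _ => 0) (Sum.elim (fun _ => 0)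
    (Sum.elim (fun i => ‖w‖ * u i) fun j => -(‖u‖ * w j)))

lemma sum_bilinCoeff_mul (u u' : EuclideanSpace ℝ ι) (w w' : EuclideanSpace ℝ τ) :
    ∑ k, bilinCoeff u w k * bilinCoeff u' w' k
      = inner ℝ u u' * inner ℝ w w' + ‖u‖ * ‖w‖ * (‖u'‖ * ‖w'‖) := by
  simp only [bilinCoeff, Fintype.sum_sum_type, Sum.elim_inl, Sum.elim_inr, mul_zero,
    Finset.sum_const_zero, add_zero, Finset.univ_unique, Finset.sum_singleton,
    PiLp.inner_apply, Finset.sum_mul_sum, Fintype.sum_prod_type]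
  congr 1
  refine Finset.sum_congr rfl fun i _ => Finset.sum_congr rfl fun j _ => ?_
  simp; ring

lemma sum_splitCoeff_mul (u u' : EuclideanSpace ℝ ι) (w w' : EuclideanSpace ℝ τ) :
    ∑ k, splitCoeff u w k * splitCoeff u' w' k
      = ‖w‖ * ‖w'‖ * inner ℝ u u' + ‖u‖ * ‖u'‖ * inner ℝ w w' := by
  simp only [splitCoeff, Fintype.sum_sum_type, Sum.elim_inl, Sum.elim_inr, mul_zero,
    Finset.sum_const_zero, zero_add, PiLp.inner_apply, Finset.mul_sum]
  congr 1
  · exact Finset.sum_congr rfl fun i _ => by simp; ring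
  · exact Finset.sum_congr rfl fun i _ => by simp; ring

lemma sum_bilinCoeff_mul_splitCoeff (u u' : EuclideanSpace ℝ ι) (w w' : EuclideanSpace ℝ τ) :
    ∑ k, bilinCoeff u w k * splitCoeff u' w' k = 0 := by
  simp [bilinCoeff, splitCoeff]

/-- The comparison of the two processes over finite families of vectors. The extra term
`γ ‖u‖ ‖w‖` equalizes the variances; the covariances then differ by the nonnegative quantity
`(‖u‖ ‖u'‖ - ⟪u, u'⟫) (‖w‖ ‖w'‖ - ⟪w, w'⟫)`, and restricting to `γ ≤ 0` costs the factor `2`. -/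
lemma measure_bilinField_le_of_fintype {I J : Type*} [Fintype I] [Fintype J]
    (w : I → EuclideanSpace ℝ τ) (u : J → EuclideanSpace ℝ ι) (t : I × J → ℝ) :
    stdGaussianPi (ι × τ) {x | ∃ i, ∀ j, bilinField x (u j) (w i) ≤ t (i, j)}
      ≤ 2 * stdGaussianPi (ι ⊕ τ) {y | ∃ i, ∀ j, splitField y (u j) (w i) ≤ t (i, j)} := by
  classical
  have hmX : MeasurableSet {x : ι × τ → ℝ | ∃ i, ∀ j, bilinField x (u j) (w i) ≤ t (i, j)} := by
    rw [show {x : ι × τ → ℝ | ∃ i, ∀ j, bilinField x (u j) (w i) ≤ t (i, j)}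
      = ⋃ i, ⋂ j, {x | bilinField x (u j) (w i) ≤ t (i, j)} by ext; simp]
    exact MeasurableSet.iUnion fun i => MeasurableSet.iInter fun j => measurableSet_le
      (continuous_bilinField.comp (by fun_prop : Continuous fun x : ι × τ → ℝ =>
        (x, u j, w i))).measurable measurable_const
  have hmY : MeasurableSet {y : ι ⊕ τ → ℝ | ∃ i, ∀ j, splitField y (u j) (w i) ≤ t (i, j)} := by
    rw [show {y : ι ⊕ τ → ℝ | ∃ i, ∀ j, splitField y (u j) (w i) ≤ t (i, j)}
      = ⋃ i, ⋂ j, {y | splitField y (u j) (w i) ≤ t (i, j)} by ext; simp]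
    exact MeasurableSet.iUnion fun i => MeasurableSet.iInter fun j => measurableSet_le
      (continuous_splitField.comp (by fun_prop : Continuous fun y : ι ⊕ τ → ℝ =>
        (y, u j, w i))).measurable measurable_const
  have hcomp := measure_exists_forall_le_of_covariance t
    (fun a => bilinCoeff (u a.2) (w a.1)) (fun a => splitCoeff (u a.2) (w a.1))
    (fun a b => sum_bilinCoeff_mul_splitCoeff _ _ _ _)
    (fun a b hab => by
      rw [sum_bilinCoeff_mul, sum_splitCoeff_mul, hab, real_inner_self_eq_norm_sq]; ring)
    (fun a b => by
      rw [sum_bilinCoeff_mul, sum_splitCoeff_mul]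
      nlinarith [mul_nonneg (sub_nonneg.2 (real_inner_le_norm (u a.2) (u b.2)))
        (sub_nonneg.2 (real_inner_le_norm (w a.1) (w b.1)))])
  set G := (ι × τ) ⊕ (Unit ⊕ (ι ⊕ τ))
  set E : Set (G → ℝ) :=
    {ξ | (fun q => ξ (Sum.inl q)) ∈ {x : ι × τ → ℝ | ∃ i, ∀ j,
      bilinField x (u j) (w i) ≤ t (i, j)}} with hE
  have hEm : MeasurableSet E := (measurable_pi_lambda _ fun q => measurable_pi_apply _) hmX
  set H : Set (G → ℝ) := {ξ | ξ (Sum.inr (Sum.inl ())) ≤ 0} with hH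
  have hHm : MeasurableSet H := measurableSet_le (measurable_pi_apply _) measurable_const
  rw [← stdGaussianPi_preimage_precomp (κ := G) (e := Sum.inl) Sum.inl_injective hmX,
    ← stdGaussianPi_preimage_precomp (κ := G) (e := fun q => Sum.inr (Sum.inr q))
      (Sum.inr_injective.comp Sum.inr_injective) hmY]
  have hflip := measure_le_two_mul_inter
    (measurePreserving_sign (κ := G) fun k => k = Sum.inr (Sum.inl ())) hEm hHm
    (by ext ξ; simp [hE]) (fun ξ => by
      simp only [hH, Set.mem_ofPred_eq, if_true, Left.neg_nonpos_iff]
      exact le_total _ _)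
  refine hflip.trans (mul_le_mul_right ((measure_mono ?_).trans (hcomp.trans (measure_mono ?_))) 2)
  · rintro ξ ⟨⟨i, hi⟩, hγ⟩
    refine ⟨i, fun j => le_trans ?_ (hi j)⟩
    have hγ' : ‖u j‖ * ‖w i‖ * ξ (Sum.inr (Sum.inl ())) ≤ 0 :=
      mul_nonpos_of_nonneg_of_nonpos (by positivity) hγ
    simp only [linForms, bilinCoeff, Fintype.sum_sum_type, Sum.elim_inl, Sum.elim_inr, zero_mul,
      Finset.sum_const_zero, add_zero, Finset.univ_unique, Finset.sum_singleton, bilinField]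
    linarith
  · rintro ξ ⟨i, hi⟩
    refine ⟨i, fun j => le_trans (le_of_eq ?_) (hi j)⟩
    simp only [linForms, splitCoeff, Fintype.sum_sum_type, Sum.elim_inl, Sum.elim_inr, zero_mul,
      Finset.sum_const_zero, zero_add, splitField, Finset.mul_sum, neg_mul,
      Finset.sum_neg_distrib, mul_assoc, sub_eq_add_neg]

/-- Gordon's inequality for bilinear Gaussian processes, with `w` in an arbitrary set `A` and `u`
in a compact set `B`. Dense sequences reduce it to finite families: the strict inequality on the
left survives a perturbation of `w`, the weak one on the right passes to limits in `u`. -/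
theorem measure_bilinField_le (A : Set (EuclideanSpace ℝ τ)) {B : Set (EuclideanSpace ℝ ι)}
    (hB : IsCompact B) {f : EuclideanSpace ℝ τ → EuclideanSpace ℝ ι → ℝ}
    (hf : Continuous (Function.uncurry f)) :
    stdGaussianPi (ι × τ) {x | ∃ w ∈ A, ∀ u ∈ B, bilinField x u w + f w u < 0}
      ≤ 2 * stdGaussianPi (ι ⊕ τ) {y | ∃ w ∈ A, ∀ u ∈ B, splitField y u w + f w u ≤ 0} := by
  classical
  rcases A.eq_empty_or_nonempty with rfl | ⟨w₀, hw₀⟩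
  · simp
  rcases B.eq_empty_or_nonempty with rfl | ⟨u₀, hu₀⟩
  · have : {y : ι ⊕ τ → ℝ | ∃ w ∈ A, ∀ u ∈ (∅ : Set (EuclideanSpace ℝ ι)),
        splitField y u w + f w u ≤ 0} = Set.univ := by
      ext y; simp only [Set.mem_ofPred_eq, Set.mem_univ, iff_true]
      exact ⟨w₀, hw₀, by simp⟩
    rw [this, measure_univ, mul_one]
    exact prob_le_one.trans (by norm_num)
  have : Nonempty A := ⟨⟨w₀, hw₀⟩⟩
  have : Nonempty B := ⟨⟨u₀, hu₀⟩⟩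
  set a := TopologicalSpace.denseSeq A with ha
  set b := TopologicalSpace.denseSeq B with hb
  set E : ℕ → Set (ι × τ → ℝ) := fun m =>
    {x | ∃ i : Fin m, ∀ u ∈ B, bilinField x u (a i) + f (a i) u ≤ 0} with hE
  set G : ℕ → ℕ → Set (ι ⊕ τ → ℝ) := fun m l =>
    {y | ∃ i : Fin m, ∀ j : Fin l, splitField y (b j : EuclideanSpace ℝ ι) (a i) ≤
      -f (a i) (b j)} with hG
  have hfc : ∀ u, Continuous fun w => f w u := fun u =>
    hf.comp (by fun_prop : Continuous fun w => (w, u))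
  have hfc' : ∀ w, Continuous fun u => f w u := fun w =>
    hf.comp (by fun_prop : Continuous fun u => (w, u))
  have hsub : {x : ι × τ → ℝ | ∃ w ∈ A, ∀ u ∈ B, bilinField x u w + f w u < 0} ⊆ ⋃ m, E m := by
    rintro x ⟨w, hwA, hw⟩
    have hopen : IsOpen {w : A | ∀ u ∈ B, bilinField x u w + f w u < 0} := by
      rw [isOpen_iff_mem_nhds]
      intro v hv
      refine hB.eventually_forall_of_forall_eventually fun u hu => ?_
      have hc : Continuous fun q : A × EuclideanSpace ℝ ι =>
          bilinField x q.2 q.1 + f q.1 q.2 :=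
        (continuous_bilinField.comp (by fun_prop : Continuous
          fun q : A × EuclideanSpace ℝ ι => (x, q.2, (q.1 : EuclideanSpace ℝ τ)))).add
        (hf.comp (by fun_prop : Continuous
          fun q : A × EuclideanSpace ℝ ι => ((q.1 : EuclideanSpace ℝ τ), q.2)))
      exact hc.continuousAt.eventually_lt_const (hv u hu)
    obtain ⟨i, hi⟩ := (TopologicalSpace.denseRange_denseSeq A).exists_mem_open hopen
      ⟨⟨w, hwA⟩, hw⟩
    exact Set.mem_iUnion.2 ⟨i + 1, ⟨⟨i, Nat.lt_succ_self i⟩, fun u hu => (hi u hu).le⟩⟩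
  have hEmono : Monotone E := by
    rintro m m' hm x ⟨i, hi⟩
    exact ⟨Fin.castLE hm i, hi⟩
  have hGanti : ∀ m, Antitone (G m) := by
    rintro m l l' hl y ⟨i, hi⟩
    exact ⟨i, fun j => hi (Fin.castLE hl j)⟩
  have hGmeas : ∀ m l, MeasurableSet (G m l) := by
    intro m l
    rw [show G m l = ⋃ i : Fin m, ⋂ j : Fin l,
      {y | splitField y (b j : EuclideanSpace ℝ ι) (a i) ≤ -f (a i) (b j)} by ext; simp [hG]]
    exact MeasurableSet.iUnion fun i => MeasurableSet.iInter fun j => measurableSet_le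
      (continuous_splitField.comp (by fun_prop : Continuous fun y : ι ⊕ τ → ℝ =>
        (y, (b j : EuclideanSpace ℝ ι), (a i : EuclideanSpace ℝ τ)))).measurable measurable_const
  have hlim : ∀ m, ⋂ l, G m l ⊆ {y | ∃ w ∈ A, ∀ u ∈ B, splitField y u w + f w u ≤ 0} := by
    intro m y hy
    rw [Set.mem_iInter] at hy
    -- one row works for all `l`: otherwise exceed the first failures of all rows at once
    obtain ⟨i, hi⟩ : ∃ i : Fin m, ∀ j : ℕ,
        splitField y (b j : EuclideanSpace ℝ ι) (a i) ≤ -f (a i) (b j) := by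
      by_contra! hcon
      choose j hj using hcon
      obtain ⟨i, hi⟩ := hy (Finset.univ.sup j + 1)
      exact (hj i).not_ge (hi ⟨j i, Nat.lt_succ_of_le (Finset.le_sup (Finset.mem_univ i))⟩)
    refine ⟨a i, (a i).2, fun u hu => ?_⟩
    have hcl : IsClosed {u : B | splitField y (u : EuclideanSpace ℝ ι) (a i) + f (a i) u ≤ 0} :=
      isClosed_le ((continuous_splitField.comp (by fun_prop : Continuous
        fun u : B => (y, (u : EuclideanSpace ℝ ι), (a i : EuclideanSpace ℝ τ)))).add
        ((hfc' _).comp continuous_subtype_val)) continuous_const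
    have := hcl.closure_subset_iff.2 (Set.range_subset_iff.2 fun j => by
      have := hi j
      simp only [Set.mem_ofPred_eq]
      linarith)
    exact this ((TopologicalSpace.denseRange_denseSeq B) ⟨u, hu⟩)
  calc _ ≤ stdGaussianPi (ι × τ) (⋃ m, E m) := measure_mono hsub
    _ = ⨆ m, stdGaussianPi (ι × τ) (E m) := hEmono.measure_iUnion
    _ ≤ _ := iSup_le fun m => ?_
  have hml : ∀ l, stdGaussianPi (ι × τ) (E m) ≤ 2 * stdGaussianPi (ι ⊕ τ) (G m l) := fun l =>
    (measure_mono (by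
      rintro x ⟨i, hi⟩
      exact ⟨i, fun j => by linarith [hi (b j) (b j).2]⟩)).trans
    (measure_bilinField_le_of_fintype (fun i : Fin m => (a i : EuclideanSpace ℝ τ))
      (fun j : Fin l => (b j : EuclideanSpace ℝ ι)) fun q => -f (a q.1) (b q.2))
  calc stdGaussianPi (ι × τ) (E m) ≤ ⨅ l, 2 * stdGaussianPi (ι ⊕ τ) (G m l) := le_iInf hml
    _ = 2 * ⨅ l, stdGaussianPi (ι ⊕ τ) (G m l) := (ENNReal.mul_iInf_of_ne (by simp) (by simp)).symm
    _ = 2 * stdGaussianPi (ι ⊕ τ) (⋂ l, G m l) := by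
        rw [(hGanti m).measure_iInter (fun l => (hGmeas m l).nullMeasurableSet)
          ⟨0, measure_ne_top _ _⟩]
    _ ≤ _ := mul_le_mul_right (measure_mono (hlim m)) 2

end Bilinear

/-! ### The optimal values as random variables -/

section Values

lemma minValue_lt_iff {E : Type*} {K : Set E} {f : E → ℝ} {c : EReal} :
    minValue K f < c ↔ ∃ w ∈ K, (f w : EReal) < c := by
  simp [minValue, iInf_lt_iff]

lemma measurable_minValue {T E : Type*} [TopologicalSpace T] [MeasurableSpace T] [BorelSpace T]
    (K : Set E) {f : T → E → ℝ} (hf : ∀ w, Continuous fun x => f x w) :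
    Measurable fun x => minValue K (f x) := by
  refine measurable_of_Iio fun c => IsOpen.measurableSet ?_
  have : (fun x => minValue K (f x)) ⁻¹' Set.Iio c = ⋃ w ∈ K, {x | (f x w : EReal) < c} := by
    ext x; simp [minValue_lt_iff]
  rw [this]
  exact isOpen_biUnion fun w _ =>
    isOpen_lt (continuous_coe_real_ereal.comp (hf w)) continuous_const

/-- The sublevel sets of a coercive function, cut with a closed set, are compact. -/
lemma isCompact_inter_sublevel {p : ℕ} {ψ : EuclideanSpace ℝ (Fin p) → ℝ} (hψ : Continuous ψ)
    (hlim : Filter.Tendsto ψ (Bornology.cobounded (EuclideanSpace ℝ (Fin p))) Filter.atTop)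
    {S : Set (EuclideanSpace ℝ (Fin p))} (hS : IsClosed S) (t : ℝ) :
    IsCompact (S ∩ {w | ψ w ≤ t}) := by
  refine Metric.isCompact_of_isClosed_isBounded (hS.inter (isClosed_le hψ continuous_const)) ?_
  refine Bornology.IsBounded.subset ?_ Set.inter_subset_right
  exact Bornology.isBounded_def.2 (Filter.mem_of_superset (hlim.eventually_gt_atTop t)
    fun w (hw : t < ψ w) => by simpa using hw)

/-- Penalization in the limit: a constraint `c w = 0` is enforced by the penalties `N * c`,
`N → ∞`. The sublevel sets of the penalized objectives in `S` are nested and compact, so they have a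
common point. -/
lemma minValue_eq_iSup_penalized {p : ℕ} {ψ c : EuclideanSpace ℝ (Fin p) → ℝ} (hψ : Continuous ψ)
    (hlim : Filter.Tendsto ψ (Bornology.cobounded (EuclideanSpace ℝ (Fin p))) Filter.atTop)
    {S : Set (EuclideanSpace ℝ (Fin p))} (hS : IsClosed S) (hc : Continuous c)
    (hc0 : ∀ w, 0 ≤ c w) :
    minValue {w | w ∈ S ∧ c w = 0} ψ = ⨆ N : ℕ, minValue S fun w => N * c w + ψ w := by
  refine le_antisymm ?_ (iSup_le fun N => le_iInf₂ fun w hw => ?_)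
  · rw [← EReal.le_of_forall_lt_iff_le]
    intro z hz
    have hN : ∀ N : ℕ, ∃ w ∈ S, N * c w + ψ w < z := by
      intro N
      obtain ⟨w, hw, h⟩ := minValue_lt_iff.1 ((le_iSup (fun N : ℕ =>
        minValue S fun w => N * c w + ψ w) N).trans_lt hz)
      exact ⟨w, hw, by exact_mod_cast h⟩
    have hcl : ∀ N : ℕ, IsClosed (S ∩ {w | N * c w + ψ w ≤ z}) := fun N =>
      hS.inter (isClosed_le (by fun_prop) continuous_const)
    obtain ⟨w, hw⟩ := IsCompact.nonempty_iInter_of_sequence_nonempty_isCompact_isClosed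
      (fun N : ℕ => S ∩ {w | N * c w + ψ w ≤ z})
      (fun N w hw => ⟨hw.1, by
        have h1 : ((N + 1 : ℕ) : ℝ) * c w + ψ w ≤ z := hw.2
        have h2 := hc0 w
        push_cast at h1
        show (N : ℝ) * c w + ψ w ≤ z
        linarith⟩)
      (fun N => by obtain ⟨w, hw, h⟩ := hN N; exact ⟨w, hw, h.le⟩)
      (by simpa using isCompact_inter_sublevel hψ hlim hS z) hcl
    rw [Set.mem_iInter] at hw
    have hall : ∀ N : ℕ, (N : ℝ) * c w + ψ w ≤ z := fun N => (hw N).2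
    have hcw : c w = 0 := by
      by_contra hne
      have hpos : 0 < c w := lt_of_le_of_ne (hc0 w) (Ne.symm hne)
      obtain ⟨N, hN⟩ := exists_nat_gt ((z - ψ w) / c w)
      rw [div_lt_iff₀ hpos] at hN
      linarith [hall N]
    refine (iInf₂_le w ⟨(hw 0).1, hcw⟩).trans ?_
    have := hall 0
    simp only [Nat.cast_zero, zero_mul, zero_add] at this
    exact_mod_cast this
  · refine (iInf₂_le w hw.1).trans ?_
    simp [hw.2]

variable {n p : ℕ}

/-- The matrix with the given entries. -/
def entryMatrix (x : Fin n × Fin p → ℝ) : Matrix (Fin n) (Fin p) ℝ := Matrix.of fun i j => x (i, j)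

/-- The first block of a vector, as an element of Euclidean space. -/
def leftPart (y : Fin n ⊕ Fin p → ℝ) : EuclideanSpace ℝ (Fin n) :=
  WithLp.toLp 2 fun i => y (Sum.inl i)

/-- The second block of a vector, as an element of Euclidean space. -/
def rightPart (y : Fin n ⊕ Fin p → ℝ) : EuclideanSpace ℝ (Fin p) :=
  WithLp.toLp 2 fun j => y (Sum.inr j)

/-- The violation `(‖w‖ ‖g‖ - ⟪h, w⟫)₊` of the auxiliary constraint. -/
noncomputable def auxGap (g : EuclideanSpace ℝ (Fin n)) (h w : EuclideanSpace ℝ (Fin p)) : ℝ :=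
  max (‖w‖ * ‖g‖ - inner ℝ h w) 0

lemma inner_entryMatrix (x : Fin n × Fin p → ℝ) (u : EuclideanSpace ℝ (Fin n))
    (w : EuclideanSpace ℝ (Fin p)) :
    inner ℝ u ((entryMatrix x).toEuclideanLin w) = bilinField x u w := by
  simp only [bilinField, PiLp.inner_apply, Fintype.sum_prod_type, Matrix.toEuclideanLin,
    Matrix.toLpLin_apply, Matrix.mulVec, dotProduct, entryMatrix, Matrix.of_apply]
  refine Finset.sum_congr rfl fun i _ => ?_
  simp only [RCLike.inner_apply, conj_trivial, Finset.sum_mul]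
  exact Finset.sum_congr rfl fun j _ => by ring

lemma splitField_eq_inner (y : Fin n ⊕ Fin p → ℝ) (u : EuclideanSpace ℝ (Fin n))
    (w : EuclideanSpace ℝ (Fin p)) :
    splitField y u w = ‖w‖ * inner ℝ (leftPart y) u - ‖u‖ * inner ℝ (rightPart y) w := by
  simp [splitField, leftPart, rightPart, PiLp.inner_apply]

lemma continuous_entryMatrix_apply :
    Continuous fun q : (Fin n × Fin p → ℝ) × EuclideanSpace ℝ (Fin p) =>
      (entryMatrix q.1).toEuclideanLin q.2 := by
  simp only [Matrix.toEuclideanLin, Matrix.toLpLin_apply, entryMatrix]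
  fun_prop

lemma continuous_auxGap :
    Continuous fun q : EuclideanSpace ℝ (Fin n) × EuclideanSpace ℝ (Fin p) ×
      EuclideanSpace ℝ (Fin p) => auxGap q.1 q.2.1 q.2.2 := by
  unfold auxGap; fun_prop

lemma continuous_parts :
    Continuous fun y : Fin n ⊕ Fin p → ℝ => (leftPart y, rightPart y) := by
  unfold leftPart rightPart; fun_prop

variable {ψ : EuclideanSpace ℝ (Fin p) → ℝ} {S : Set (EuclideanSpace ℝ (Fin p))}

lemma primaryValue_of_ne_top {lam : ℝ≥0∞} (h : lam ≠ ∞) (X : Matrix (Fin n) (Fin p) ℝ) :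
    primaryValue ψ S lam X = minValue S fun w => lam.toReal * ‖X.toEuclideanLin w‖ + ψ w := by
  simp [primaryValue, h]

lemma auxiliaryValue_of_ne_top {lam : ℝ≥0∞} (hl : lam ≠ ∞) (g : EuclideanSpace ℝ (Fin n))
    (h : EuclideanSpace ℝ (Fin p)) :
    auxiliaryValue ψ S lam g h = minValue S fun w => lam.toReal * auxGap g h w + ψ w := by
  simp [auxiliaryValue, hl, auxGap]

lemma primaryValue_top (hψ : Continuous ψ)
    (hlim : Filter.Tendsto ψ (Bornology.cobounded (EuclideanSpace ℝ (Fin p))) Filter.atTop)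
    (hS : IsClosed S) (X : Matrix (Fin n) (Fin p) ℝ) :
    primaryValue ψ S ∞ X = ⨆ N : ℕ, primaryValue ψ S N X := by
  have h := minValue_eq_iSup_penalized hψ hlim hS (c := fun w => ‖X.toEuclideanLin w‖)
    ((LinearMap.continuous_of_finiteDimensional _).norm) fun _ => norm_nonneg _
  simp_rw [primaryValue_of_ne_top (ENNReal.natCast_ne_top _)]
  simpa [primaryValue] using h

lemma auxiliaryValue_top (hψ : Continuous ψ)
    (hlim : Filter.Tendsto ψ (Bornology.cobounded (EuclideanSpace ℝ (Fin p))) Filter.atTop)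
    (hS : IsClosed S) (g : EuclideanSpace ℝ (Fin n)) (h : EuclideanSpace ℝ (Fin p)) :
    auxiliaryValue ψ S ∞ g h = ⨆ N : ℕ, auxiliaryValue ψ S N g h := by
  have hc : Continuous fun w : EuclideanSpace ℝ (Fin p) => auxGap g h w := by
    unfold auxGap; fun_prop
  have hsup := minValue_eq_iSup_penalized hψ hlim hS hc fun _ => le_max_right _ _
  simp_rw [auxiliaryValue_of_ne_top (ENNReal.natCast_ne_top _)]
  simpa [auxiliaryValue, auxGap] using hsup

lemma primaryValue_natCast_mono (X : Matrix (Fin n) (Fin p) ℝ) :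
    Monotone fun N : ℕ => primaryValue ψ S N X := by
  intro N M h
  simp only [primaryValue_of_ne_top (ENNReal.natCast_ne_top _), ENNReal.toReal_natCast]
  refine iInf₂_mono fun w _ => ?_
  have : (N : ℝ) ≤ M := by exact_mod_cast h
  exact_mod_cast add_le_add_left (mul_le_mul_of_nonneg_right this (norm_nonneg _)) _

lemma auxiliaryValue_natCast_mono (g : EuclideanSpace ℝ (Fin n)) (h : EuclideanSpace ℝ (Fin p)) :
    Monotone fun N : ℕ => auxiliaryValue ψ S N g h := by
  intro N M h
  simp only [auxiliaryValue_of_ne_top (ENNReal.natCast_ne_top _), ENNReal.toReal_natCast]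
  refine iInf₂_mono fun w _ => ?_
  have : (N : ℝ) ≤ M := by exact_mod_cast h
  exact_mod_cast add_le_add_left (mul_le_mul_of_nonneg_right this (le_max_right _ _)) _

lemma measurable_primaryValue (hψ : Continuous ψ)
    (hlim : Filter.Tendsto ψ (Bornology.cobounded (EuclideanSpace ℝ (Fin p))) Filter.atTop)
    (hS : IsClosed S) (lam : ℝ≥0∞) :
    Measurable fun x : Fin n × Fin p → ℝ => primaryValue ψ S lam (entryMatrix x) := by
  have hfin : ∀ lam : ℝ≥0∞, lam ≠ ∞ →
      Measurable fun x : Fin n × Fin p → ℝ => primaryValue ψ S lam (entryMatrix x) := by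
    intro lam h
    simp only [primaryValue_of_ne_top h]
    refine measurable_minValue S fun w => ?_
    exact ((continuous_entryMatrix_apply.comp (by fun_prop : Continuous
      fun x : Fin n × Fin p → ℝ => (x, w))).norm.const_mul _).add_const _
  by_cases h : lam = ∞
  · subst h
    simp only [primaryValue_top hψ hlim hS]
    exact Measurable.iSup fun N => hfin _ (ENNReal.natCast_ne_top N)
  · exact hfin lam h

lemma measurable_auxiliaryValue (hψ : Continuous ψ)
    (hlim : Filter.Tendsto ψ (Bornology.cobounded (EuclideanSpace ℝ (Fin p))) Filter.atTop)
    (hS : IsClosed S) (lam : ℝ≥0∞) :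
    Measurable fun y : Fin n ⊕ Fin p → ℝ =>
      auxiliaryValue ψ S lam (leftPart y) (rightPart y) := by
  have hfin : ∀ lam : ℝ≥0∞, lam ≠ ∞ → Measurable fun y : Fin n ⊕ Fin p → ℝ =>
      auxiliaryValue ψ S lam (leftPart y) (rightPart y) := by
    intro lam h
    simp only [auxiliaryValue_of_ne_top h]
    refine measurable_minValue S fun w => ?_
    have h1 : Continuous fun y : Fin n ⊕ Fin p → ℝ => (leftPart y, rightPart y, w) :=
      (continuous_fst.comp continuous_parts).prodMk
        ((continuous_snd.comp continuous_parts).prodMk continuous_const)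
    exact ((continuous_auxGap.comp h1).const_mul _).add_const _
  by_cases h : lam = ∞
  · subst h
    simp only [auxiliaryValue_top hψ hlim hS]
    exact Measurable.iSup fun N => hfin _ (ENNReal.natCast_ne_top N)
  · exact hfin lam h

end Values

/-! ### The two tail bounds -/

section Tails

variable {n p : ℕ} {ψ : EuclideanSpace ℝ (Fin p) → ℝ} {S : Set (EuclideanSpace ℝ (Fin p))}

lemma exists_norm_eq_inner_eq_of_ne_zero {E : Type*} [NormedAddCommGroup E]
    [InnerProductSpace ℝ E] {r : ℝ} (hr : 0 ≤ r) {v : E} (hv : v ≠ 0) :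
    ∃ u : E, ‖u‖ = r ∧ inner ℝ v u = r * ‖v‖ := by
  have hv' : ‖v‖ ≠ 0 := norm_ne_zero_iff.2 hv
  refine ⟨(r / ‖v‖) • v, ?_, ?_⟩
  · rw [norm_smul, Real.norm_of_nonneg (by positivity), div_mul_cancel₀ _ hv']
  · rw [inner_smul_right, real_inner_self_eq_norm_sq]
    field_simp

/-- The maximum of `⟪v, u⟫` over the ball `‖u‖ ≤ r` is `r * ‖v‖`. -/
lemma exists_norm_le_inner_eq {E : Type*} [NormedAddCommGroup E] [InnerProductSpace ℝ E]
    {r : ℝ} (hr : 0 ≤ r) (v : E) : ∃ u : E, ‖u‖ ≤ r ∧ inner ℝ v u = r * ‖v‖ := by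
  by_cases hv : v = 0
  · exact ⟨0, by simpa using hr, by simp [hv]⟩
  · obtain ⟨u, hu, hu'⟩ := exists_norm_eq_inner_eq_of_ne_zero hr hv
    exact ⟨u, hu.le, hu'⟩

/-- In positive dimension the maximum is attained on the sphere, also for `v = 0`. -/
lemma exists_norm_eq_inner_eq [NeZero n] {r : ℝ} (hr : 0 ≤ r) (v : EuclideanSpace ℝ (Fin n)) :
    ∃ u : EuclideanSpace ℝ (Fin n), ‖u‖ = r ∧ inner ℝ v u = r * ‖v‖ := by
  by_cases hv : v = 0
  · exact ⟨r • EuclideanSpace.single 0 1, by simp [norm_smul, abs_of_nonneg hr], by simp [hv]⟩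
  · exact exists_norm_eq_inner_eq_of_ne_zero hr hv

/-- For `n = 0` the primary value is deterministic, and the bound holds because a fixed `w ∈ S`
pays no penalty in the auxiliary problem with probability at least one half, by symmetry of
`⟪h, w⟫`. -/
lemma measure_primaryValue_lt_le_of_dim_zero {r : ℝ≥0∞} (hr : r ≠ ∞) (t : ℝ) :
    stdGaussianPi (Fin 0 × Fin p) {x | primaryValue ψ S r (entryMatrix x) < (t : EReal)}
      ≤ 2 * stdGaussianPi (Fin 0 ⊕ Fin p)
        {y | auxiliaryValue ψ S r (leftPart y) (rightPart y) ≤ (t : EReal)} := by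
  simp only [primaryValue_of_ne_top hr, auxiliaryValue_of_ne_top hr]
  by_cases hex : ∃ w ∈ S, ψ w < t
  · obtain ⟨w, hwS, hw⟩ := hex
    have hmeas : MeasurableSet {y : Fin 0 ⊕ Fin p → ℝ | 0 ≤ inner ℝ (rightPart y) w} :=
      (isClosed_le continuous_const (((continuous_snd.comp continuous_parts).inner
        continuous_const))).measurableSet
    have h := measure_le_two_mul_inter
      (measurePreserving_sign (κ := Fin 0 ⊕ Fin p) fun _ => True)
      (E := Set.univ) MeasurableSet.univ hmeas rfl (fun y => by
        have : rightPart (fun k => if True then -y k else y k) = -rightPart y := by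
          ext j; simp [rightPart]
        simp only [Set.mem_ofPred_eq, this, inner_neg_left, Left.nonneg_neg_iff]
        exact le_total _ _)
    rw [measure_univ, Set.univ_inter] at h
    refine prob_le_one.trans (h.trans (mul_le_mul_right (measure_mono fun y hy => ?_) 2))
    rw [Set.mem_ofPred_eq]
    refine (iInf₂_le w hwS).trans ?_
    have hg : leftPart y = 0 := Subsingleton.elim _ _
    have hy' : 0 ≤ inner ℝ (rightPart y) w := hy
    have : auxGap (leftPart y) (rightPart y) w = 0 := by
      simp [auxGap, hg, hy']
    simpa [this] using hw.le
  · have : {x : Fin 0 × Fin p → ℝ | (minValue S fun w =>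
        r.toReal * ‖(entryMatrix x).toEuclideanLin w‖ + ψ w) < (t : EReal)} = ∅ := by
      rw [Set.eq_empty_iff_forall_notMem]
      intro x hx
      obtain ⟨w, hw, h⟩ := minValue_lt_iff.1 hx
      refine hex ⟨w, hw, ?_⟩
      have h0 : (entryMatrix x).toEuclideanLin w = 0 := Subsingleton.elim _ _
      rw [h0, norm_zero, mul_zero, zero_add] at h
      exact_mod_cast h
    rw [this]; simp

/-- The lower tail for a finite penalty: Gordon's inequality with `w ∈ S` outside and `‖u‖ ≤ r`
inside. -/
lemma measure_primaryValue_lt_le_of_ne_top (hψ : Continuous ψ) {r : ℝ≥0∞} (hr : r ≠ ∞) (t : ℝ) :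
    stdGaussianPi (Fin n × Fin p) {x | primaryValue ψ S r (entryMatrix x) < (t : EReal)}
      ≤ 2 * stdGaussianPi (Fin n ⊕ Fin p)
        {y | auxiliaryValue ψ S r (leftPart y) (rightPart y) ≤ (t : EReal)} := by
  rcases Nat.eq_zero_or_pos n with rfl | hn
  · exact measure_primaryValue_lt_le_of_dim_zero hr t
  have : NeZero n := ⟨hn.ne'⟩
  have hr0 : 0 ≤ r.toReal := ENNReal.toReal_nonneg
  have key := measure_bilinField_le S
    (isCompact_closedBall (0 : EuclideanSpace ℝ (Fin n)) r.toReal)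
    (f := fun w _ => ψ w - t) (by simp only [Function.uncurry_def]; fun_prop)
  refine (measure_mono fun x hx => ?_).trans
    (key.trans (mul_le_mul_right (measure_mono fun y hy => ?_) 2))
  · rw [Set.mem_ofPred_eq, primaryValue_of_ne_top hr] at hx
    obtain ⟨w, hw, h⟩ := minValue_lt_iff.1 hx
    have h' : r.toReal * ‖(entryMatrix x).toEuclideanLin w‖ + ψ w < t := by exact_mod_cast h
    refine ⟨w, hw, fun u hu => ?_⟩
    rw [mem_closedBall_zero_iff] at hu
    have h1 := real_inner_le_norm u ((entryMatrix x).toEuclideanLin w)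
    rw [inner_entryMatrix] at h1
    have h2 := mul_le_mul_of_nonneg_right hu (norm_nonneg ((entryMatrix x).toEuclideanLin w))
    linarith
  · obtain ⟨w, hw, h⟩ := hy
    rw [Set.mem_ofPred_eq, auxiliaryValue_of_ne_top hr]
    refine (iInf₂_le w hw).trans ?_
    -- test with `u = 0` and with the maximizer of `⟪g, u⟫` on the sphere `‖u‖ = r`
    have h0 := h 0 (by simp)
    obtain ⟨u, hu, hu'⟩ := exists_norm_eq_inner_eq hr0 (leftPart y)
    have h1 := h u (by simp [hu])
    rw [splitField_eq_inner] at h0 h1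
    rw [hu, hu'] at h1
    have : r.toReal * auxGap (leftPart y) (rightPart y) w + ψ w ≤ t := by
      rcases le_total (‖w‖ * ‖leftPart y‖ - inner ℝ (rightPart y) w) 0 with hle | hle
      · rw [auxGap, max_eq_right hle]
        simp at h0
        linarith
      · rw [auxGap, max_eq_left hle]
        linarith
    exact_mod_cast this

/-- Sion's minimax theorem, in the form needed here: if the primary objective exceeds `t` on a
compact convex set, a single dual vector `u` certifies this. -/
lemma exists_forall_lt_bilinField {K : Set (EuclideanSpace ℝ (Fin p))} (hK : IsCompact K)
    (hKc : Convex ℝ K) (hψ : Continuous ψ) (hψc : ConvexOn ℝ Set.univ ψ) {r : ℝ} (hr : 0 ≤ r)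
    {t : ℝ} (x : Fin n × Fin p → ℝ)
    (h : ∀ w ∈ K, t < r * ‖(entryMatrix x).toEuclideanLin w‖ + ψ w) :
    ∃ u : EuclideanSpace ℝ (Fin n), ‖u‖ ≤ r ∧ ∀ w ∈ K, t < bilinField x u w + ψ w := by
  rcases K.eq_empty_or_nonempty with rfl | hne
  · exact ⟨0, by simpa using hr, by simp⟩
  set L := (entryMatrix x).toEuclideanLin with hL
  have hLc : Continuous L := LinearMap.continuous_of_finiteDimensional _
  obtain ⟨a, ha, b, hb, hab⟩ := Sion.exists_isSaddlePointOn' (X := K)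
    (Y := Metric.closedBall (0 : EuclideanSpace ℝ (Fin n)) r)
    (f := fun w u => inner ℝ u (L w) + ψ w) hne hK
    (fun u _ => (by fun_prop : Continuous fun w => inner ℝ u (L w) + ψ w).continuousOn
      |>.lowerSemicontinuousOn)
    (fun u _ => by
      have h1 : ConvexOn ℝ K fun w => inner ℝ u (L w) :=
        ((innerₛₗ ℝ u).comp L).convexOn hKc
      exact (h1.add (hψc.subset (Set.subset_univ _) hKc)).quasiconvexOn)
    (convex_closedBall _ _) (isCompact_closedBall _ _)
    (fun w _ => (by fun_prop : Continuous fun u => inner ℝ u (L w) + ψ w).continuousOn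
      |>.upperSemicontinuousOn)
    (fun w _ => by
      have h1 : ConcaveOn ℝ (Metric.closedBall (0 : EuclideanSpace ℝ (Fin n)) r)
          fun u => inner ℝ u (L w) := by
        exact ((innerₛₗ ℝ (L w)).concaveOn (convex_closedBall _ _)).congr
          fun u _ => real_inner_comm u (L w)
      exact (h1.add_const (ψ w)).quasiconcaveOn)
    hKc ⟨0, by simpa using hr⟩
  refine ⟨b, mem_closedBall_zero_iff.1 hb, fun w hw => ?_⟩
  obtain ⟨u, hu, hu'⟩ := exists_norm_le_inner_eq hr (L a)
  have h1 : inner ℝ u (L a) + ψ a ≤ inner ℝ b (L w) + ψ w :=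
    hab w hw u (mem_closedBall_zero_iff.2 hu)
  rw [real_inner_comm, hu', hL, inner_entryMatrix] at h1
  exact (h a ha).trans_le h1

/-- The upper tail for a finite penalty in the convex case: after exchanging minimum and maximum,
Gordon's inequality applies with `‖u‖ ≤ r` outside and `w` inside, to the negated objective. -/
lemma measure_lt_primaryValue_le_of_ne_top (hψ : Continuous ψ)
    (hlim : Filter.Tendsto ψ (Bornology.cobounded (EuclideanSpace ℝ (Fin p))) Filter.atTop)
    (hS : IsClosed S) (hSc : Convex ℝ S) (hψc : ConvexOn ℝ Set.univ ψ) {r : ℝ≥0∞} (hr : r ≠ ∞)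
    (t : ℝ) :
    stdGaussianPi (Fin n × Fin p) {x | (t : EReal) < primaryValue ψ S r (entryMatrix x)}
      ≤ 2 * stdGaussianPi (Fin n ⊕ Fin p)
        {y | (t : EReal) ≤ auxiliaryValue ψ S r (leftPart y) (rightPart y)} := by
  have hr0 : 0 ≤ r.toReal := ENNReal.toReal_nonneg
  set K := S ∩ {w | ψ w ≤ t} with hKdef
  have hK : IsCompact K := isCompact_inter_sublevel hψ hlim hS t
  have hKc : Convex ℝ K := hSc.inter (by simpa using hψc.convex_le t)
  have key := measure_bilinField_le (ι := Fin p) (τ := Fin n)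
    (Metric.closedBall (0 : EuclideanSpace ℝ (Fin n)) r.toReal) hK
    (f := fun _ w => t - ψ w) (by simp only [Function.uncurry_def]; fun_prop)
  -- the two Gaussian arrays are read with the roles of the two spaces exchanged
  rw [← stdGaussianPi_preimage_precomp (e := Prod.swap) Prod.swap_injective
      (measurableSet_lt measurable_const (measurable_primaryValue hψ hlim hS r)),
    ← stdGaussianPi_preimage_precomp (e := Sum.swap) (Equiv.sumComm _ _).injective
      (measurableSet_le measurable_const (measurable_auxiliaryValue hψ hlim hS r))]
  refine (measure_mono fun x hx => ?_).trans
    (key.trans (mul_le_mul_right (measure_mono fun y hy => ?_) 2))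
  · rw [Set.mem_ofPred_eq, Set.mem_ofPred_eq, primaryValue_of_ne_top hr] at hx
    obtain ⟨u, hu, h⟩ := exists_forall_lt_bilinField hK hKc hψ hψc hr0 (t := t)
      (fun q => x q.swap) (fun w hw => by
        have := hx.trans_le (iInf₂_le w hw.1)
        exact_mod_cast this)
    refine ⟨-u, by simpa using hu, fun w hw => ?_⟩
    have h1 : bilinField x w (-u) = -bilinField (fun q : Fin n × Fin p => x q.swap) u w := by
      simp only [bilinField, ← Finset.sum_neg_distrib]
      refine Fintype.sum_equiv (Equiv.prodComm _ _) _ _ fun q => ?_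
      simp [mul_comm]
    have h2 := h w hw
    rw [h1]
    linarith
  · obtain ⟨u, hu, h⟩ := hy
    rw [mem_closedBall_zero_iff] at hu
    rw [Set.mem_ofPred_eq, Set.mem_ofPred_eq, auxiliaryValue_of_ne_top hr]
    refine le_iInf₂ fun w hw => ?_
    set y' : Fin n ⊕ Fin p → ℝ := fun k => y k.swap with hy'
    have hgap : 0 ≤ auxGap (leftPart y') (rightPart y') w := le_max_right _ _
    suffices hs : t ≤ r.toReal * auxGap (leftPart y') (rightPart y') w + ψ w by exact_mod_cast hs
    by_cases hwt : ψ w ≤ t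
    · have h1 := h w ⟨hw, hwt⟩
      rw [splitField_eq_inner] at h1
      have e1 : leftPart y = rightPart y' := rfl
      have e2 : rightPart y = leftPart y' := rfl
      rw [e1, e2] at h1
      have h2 := mul_le_mul_of_nonneg_left (real_inner_le_norm (leftPart y') u) (norm_nonneg w)
      have h3 : ‖w‖ * ‖leftPart y'‖ - inner ℝ (rightPart y') w
          ≤ auxGap (leftPart y') (rightPart y') w := le_max_left _ _
      have h4 := mul_le_mul_of_nonneg_left h3 (norm_nonneg u)
      have h5 := mul_le_mul_of_nonneg_right hu hgap
      nlinarith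
    · have := mul_nonneg hr0 hgap
      linarith

/-- The lower tail for every penalty. For `lam = ∞` the events for the auxiliary problem decrease to
their limit as the penalty grows. -/
theorem measure_primaryValue_lt_le (hψ : Continuous ψ)
    (hlim : Filter.Tendsto ψ (Bornology.cobounded (EuclideanSpace ℝ (Fin p))) Filter.atTop)
    (hS : IsClosed S) (lam : ℝ≥0∞) (t : ℝ) :
    stdGaussianPi (Fin n × Fin p) {x | primaryValue ψ S lam (entryMatrix x) < (t : EReal)}
      ≤ 2 * stdGaussianPi (Fin n ⊕ Fin p)
        {y | auxiliaryValue ψ S lam (leftPart y) (rightPart y) ≤ (t : EReal)} := by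
  by_cases hl : lam = ∞
  · subst hl
    have hset : {y : Fin n ⊕ Fin p → ℝ |
        auxiliaryValue ψ S ∞ (leftPart y) (rightPart y) ≤ (t : EReal)}
        = ⋂ N : ℕ, {y | auxiliaryValue ψ S N (leftPart y) (rightPart y) ≤ (t : EReal)} := by
      ext y; simp [auxiliaryValue_top hψ hlim hS]
    have hanti : Antitone fun N : ℕ => {y : Fin n ⊕ Fin p → ℝ |
        auxiliaryValue ψ S N (leftPart y) (rightPart y) ≤ (t : EReal)} :=
      fun N M h y hy => (auxiliaryValue_natCast_mono _ _ h).trans hy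
    rw [hset, hanti.measure_iInter (fun N => (measurableSet_le
      (measurable_auxiliaryValue hψ hlim hS N) measurable_const).nullMeasurableSet)
      ⟨0, measure_ne_top _ _⟩, ENNReal.mul_iInf_of_ne (by simp) (by simp)]
    refine le_iInf fun N => (measure_mono fun x hx => ?_).trans
      (measure_primaryValue_lt_le_of_ne_top hψ (ENNReal.natCast_ne_top N) t)
    rw [Set.mem_ofPred_eq, primaryValue_top hψ hlim hS] at hx
    exact (le_iSup (fun N : ℕ => primaryValue ψ S N (entryMatrix x)) N).trans_lt hx
  · exact measure_primaryValue_lt_le_of_ne_top hψ hl t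

/-- The upper tail for every penalty in the convex case. For `lam = ∞` the events for the primary
problem increase to their limit as the penalty grows. -/
theorem measure_lt_primaryValue_le (hψ : Continuous ψ)
    (hlim : Filter.Tendsto ψ (Bornology.cobounded (EuclideanSpace ℝ (Fin p))) Filter.atTop)
    (hS : IsClosed S) (hSc : Convex ℝ S) (hψc : ConvexOn ℝ Set.univ ψ) (lam : ℝ≥0∞) (t : ℝ) :
    stdGaussianPi (Fin n × Fin p) {x | (t : EReal) < primaryValue ψ S lam (entryMatrix x)}
      ≤ 2 * stdGaussianPi (Fin n ⊕ Fin p)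
        {y | (t : EReal) ≤ auxiliaryValue ψ S lam (leftPart y) (rightPart y)} := by
  by_cases hl : lam = ∞
  · subst hl
    have hset : {x : Fin n × Fin p → ℝ | (t : EReal) < primaryValue ψ S ∞ (entryMatrix x)}
        = ⋃ N : ℕ, {x | (t : EReal) < primaryValue ψ S N (entryMatrix x)} := by
      ext x; simp [primaryValue_top hψ hlim hS, lt_iSup_iff]
    have hmono : Monotone fun N : ℕ => {x : Fin n × Fin p → ℝ |
        (t : EReal) < primaryValue ψ S N (entryMatrix x)} :=
      fun N M h x hx => hx.trans_le (primaryValue_natCast_mono _ h)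
    rw [hset, hmono.measure_iUnion]
    refine iSup_le fun N => (measure_lt_primaryValue_le_of_ne_top hψ hlim hS hSc hψc
      (ENNReal.natCast_ne_top N) t).trans (mul_le_mul_right (measure_mono fun y hy => ?_) 2)
    rw [Set.mem_ofPred_eq, auxiliaryValue_top hψ hlim hS]
    exact le_iSup_of_le N hy
  · exact measure_lt_primaryValue_le_of_ne_top hψ hlim hS hSc hψc hl t

/-- A value far from `μ` lies far below or far above it; infinite values count as far on their own
side. -/
lemma EReal.lt_or_lt_of_lt_abs_sub {v : EReal} {μ t : ℝ}
    (h : ENNReal.ofReal t < (v - (μ : EReal)).abs) :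
    v < ((μ - t : ℝ) : EReal) ∨ ((μ + t : ℝ) : EReal) < v := by
  induction v with
  | bot => exact Or.inl (EReal.bot_lt_coe _)
  | top => exact Or.inr (EReal.coe_lt_top _)
  | coe v =>
    rw [← EReal.coe_sub, EReal.abs_def] at h
    have h' : t < |v - μ| := lt_of_not_ge fun hle => h.not_ge (ENNReal.ofReal_le_ofReal hle)
    rcases lt_abs.1 h' with h' | h'
    · exact Or.inr (by exact_mod_cast (by linarith : μ + t < v))
    · exact Or.inl (by exact_mod_cast (by linarith : v < μ - t))

lemma EReal.le_abs_sub_of_le_or_le {v : EReal} {μ t : ℝ}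
    (h : v ≤ ((μ - t : ℝ) : EReal) ∨ ((μ + t : ℝ) : EReal) ≤ v) :
    ENNReal.ofReal t ≤ (v - (μ : EReal)).abs := by
  induction v with
  | bot => simp
  | top => simp
  | coe v =>
    rw [← EReal.coe_sub, EReal.abs_def]
    refine ENNReal.ofReal_le_ofReal ?_
    rcases h with h | h
    · have h : v ≤ μ - t := by exact_mod_cast h
      exact le_trans (by linarith) (neg_le_abs _)
    · have h : μ + t ≤ v := by exact_mod_cast h
      exact le_trans (by linarith) (le_abs_self _)

end Tails

theorem theorem3 {Ω Ω' : Type*} [MeasurableSpace Ω] [MeasurableSpace Ω']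
    (P : Measure Ω) [IsProbabilityMeasure P] (P' : Measure Ω') [IsProbabilityMeasure P']
    (n p : ℕ)
    (X : Ω → Matrix (Fin n) (Fin p) ℝ)
    (hX : IsStdGaussianFamily P (fun (ij : Fin n × Fin p) ω => X ω ij.1 ij.2))
    (g : Ω' → EuclideanSpace ℝ (Fin n)) (h : Ω' → EuclideanSpace ℝ (Fin p))
    (hgh : IsStdGaussianFamily P'
      (Sum.elim (fun (i : Fin n) ω => g ω i) (fun (j : Fin p) ω => h ω j)))
    (ψ : EuclideanSpace ℝ (Fin p) → ℝ) (hψ : Continuous ψ)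
    (hψ_lim : Filter.Tendsto ψ (Bornology.cobounded (EuclideanSpace ℝ (Fin p))) Filter.atTop)
    (S : Set (EuclideanSpace ℝ (Fin p))) (hS : IsClosed S)
    (lam : ℝ≥0∞) :
    (∀ t : ℝ,
      P {ω | primaryValue ψ S lam (X ω) < (t : EReal)}
        ≤ 2 * P' {ω | auxiliaryValue ψ S lam (g ω) (h ω) ≤ (t : EReal)}) ∧
    (Convex ℝ S → ConvexOn ℝ Set.univ ψ →
      (∀ t : ℝ,
        P {ω | primaryValue ψ S lam (X ω) > (t : EReal)}
          ≤ 2 * P' {ω | auxiliaryValue ψ S lam (g ω) (h ω) ≥ (t : EReal)}) ∧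
      (∀ μ t : ℝ, 0 < t →
        P {ω | (primaryValue ψ S lam (X ω) - (μ : EReal)).abs > ENNReal.ofReal t}
          ≤ 2 * P' {ω | (auxiliaryValue ψ S lam (g ω) (h ω) - (μ : EReal)).abs
              ≥ ENNReal.ofReal t})) := by
  have hmP := measurable_primaryValue (n := n) hψ hψ_lim hS lam
  have hmA := measurable_auxiliaryValue (n := n) hψ hψ_lim hS lam
  have lawP : ∀ s : Set EReal, MeasurableSet s → P {ω | primaryValue ψ S lam (X ω) ∈ s}
      = stdGaussianPi (Fin n × Fin p) {x | primaryValue ψ S lam (entryMatrix x) ∈ s} :=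
    fun s hs => hX.measure_setOf (hmP hs)
  have lawA : ∀ s : Set EReal, MeasurableSet s →
      P' {ω | auxiliaryValue ψ S lam (g ω) (h ω) ∈ s} = stdGaussianPi (Fin n ⊕ Fin p)
        {y | auxiliaryValue ψ S lam (leftPart y) (rightPart y) ∈ s} :=
    fun s hs => hgh.measure_setOf (hmA hs)
  have lower : ∀ t : ℝ, P {ω | primaryValue ψ S lam (X ω) < (t : EReal)}
      ≤ 2 * P' {ω | auxiliaryValue ψ S lam (g ω) (h ω) ≤ (t : EReal)} := fun t =>
    (lawP (Set.Iio t) measurableSet_Iio).trans_le ((measure_primaryValue_lt_le hψ hψ_lim hS lam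
      t).trans_eq (congrArg (2 * ·) (lawA (Set.Iic t) measurableSet_Iic).symm))
  refine ⟨lower, fun hSc hψc => ?_⟩
  have upper : ∀ t : ℝ, P {ω | primaryValue ψ S lam (X ω) > (t : EReal)}
      ≤ 2 * P' {ω | auxiliaryValue ψ S lam (g ω) (h ω) ≥ (t : EReal)} := fun t =>
    (lawP (Set.Ioi t) measurableSet_Ioi).trans_le ((measure_lt_primaryValue_le hψ hψ_lim hS hSc
      hψc lam t).trans_eq (congrArg (2 * ·) (lawA (Set.Ici t) measurableSet_Ici).symm))
  refine ⟨upper, fun μ t ht => ?_⟩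
  have hdisj : Disjoint (Set.Iic (((μ - t : ℝ) : EReal))) (Set.Ici ((μ + t : ℝ) : EReal)) := by
    rw [Set.Iic_disjoint_Ici, not_le]
    exact_mod_cast (by linarith : μ - t < μ + t)
  calc P {ω | (primaryValue ψ S lam (X ω) - (μ : EReal)).abs > ENNReal.ofReal t}
      ≤ P ({ω | primaryValue ψ S lam (X ω) < ((μ - t : ℝ) : EReal)} ∪
          {ω | primaryValue ψ S lam (X ω) > ((μ + t : ℝ) : EReal)}) :=
        measure_mono fun ω hω => EReal.lt_or_lt_of_lt_abs_sub hω
    _ ≤ _ := measure_union_le _ _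
    _ ≤ _ := add_le_add (lower _) (upper _)
    _ = 2 * P' {ω | auxiliaryValue ψ S lam (g ω) (h ω) ∈
          Set.Iic ((μ - t : ℝ) : EReal) ∪ Set.Ici ((μ + t : ℝ) : EReal)} := by
        rw [← mul_add, lawA _ (measurableSet_Iic.union measurableSet_Ici)]
        congr 1
        refine Eq.trans (congrArg₂ (· + ·) (lawA (Set.Iic _) measurableSet_Iic)
          (lawA (Set.Ici _) measurableSet_Ici)) ?_
        exact (measure_union (hdisj.preimage _) (hmA measurableSet_Ici)).symm
    _ ≤ _ := mul_le_mul_right (measure_mono fun ω hω => EReal.le_abs_sub_of_le_or_le hω) 2
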